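/- Let $1 \le p < 2$, and let $(b_n)_{n\ge 1}$ be a sequence of positive real numbers such that $(b_n/n^{1/p})_{n\ge1}$ is nondecreasing. Let $(\mathbf B, \|\cdot\|)$ be a real separable Banach space of Rademacher type $p$; that is, for a sequence $(R_n)_{n\ge1}$ of i.i.d. random variables with $\mathbb P(R_n = 1) = \mathbb P(R_n = -1) = 1/2$, there is a constant $0<C<\infty$ such that $$\mathbb E\Big\|\sum_{n=1}^\infty R_n v_n\Big\|^p \le C \sum_{n=1}^\infty \|v_n\|^p$$ for every sequence $(v_n)_{n\ge1}$ in $\mathbf B$ for which $\sum_n R_n v_n$ converges in probability. Let $X, X_1, X_2, \dots$ be $\mathbf B$-valued (Borel measurable) random variables on a probability space such that $X_1, X_2, \dots$ are independent and each $X_n$ has the same distribution as $X$. Put $S_n = \sum_{i=1}^n X_i$ and $\gamma_n = n\,\mathbb E\big(X\, I\{\|X\| \le b_n\}\big)$ for $n \ge 1$. Then $$\lim_{n\to\infty} \frac{S_n - \gamma_n}{b_n} = 0 \ \text{ a.s.} \quad\text{if and only if}\quad \sum_{n=1}^\infty \mathbb P(\|X\| > b_n) < \infty,$$ and $$\limsup_{n\to\infty}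 \frac{\|S_n - \gamma_n\|}{b_n} = \infty \ \text{ a.s.} \quad\text{if and only if}\quad \sum_{n=1}^\infty \mathbb P(\|X\| > b_n) = \infty.$$ In particular, one of the two almost sure statements always holds, according as the series converges or diverges. -/

import Mathlib

open MeasureTheory ProbabilityTheory Filter Topology
open scoped ENNReal NNReal

noncomputable section

/-- The law of a random sign: mass `1/2` at `1` and mass `1/2` at `-1`. -/
def rademacherLaw : Measure ℝ :=
  (2⁻¹ : ℝ≥0∞) • Measure.dirac 1 + (2⁻¹ : ℝ≥0∞) • Measure.dirac (-1)

instance : IsProbabilityMeasure rademacherLaw where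
  measure_univ := by simp [rademacherLaw, ENNReal.inv_two_add_inv_two]

/-- The joint law of a Rademacher sequence: under this measure on `ℕ → ℝ` the coordinates
`r ↦ r n` are i.i.d. random signs. -/
def rademacherMeasure : Measure (ℕ → ℝ) :=
  Measure.infinitePi fun _ : ℕ => rademacherLaw

/-- `B` is of Rademacher type `p`: there is `0 < C < ∞` such that, whenever the random series
`∑ R_n v_n` converges in probability, with sum `T`, one has `E ‖T‖ ^ p ≤ C ∑ ‖v_n‖ ^ p`
(both sides valued in `[0, ∞]`). -/
def IsRademacherType (B : Type*) [NormedAddCommGroup B] [NormedSpace ℝ B] (p : ℝ) : Prop :=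
  ∃ C : ℝ≥0, 0 < C ∧ ∀ (v : ℕ → B) (T : (ℕ → ℝ) → B), StronglyMeasurable T →
    TendstoInMeasure rademacherMeasure
      (fun (N : ℕ) (r : ℕ → ℝ) => ∑ n ∈ Finset.range N, r n • v n) atTop T →
    ∫⁻ r, ‖T r‖ₑ ^ p ∂rademacherMeasure ≤ C * ∑' n, ‖v n‖ₑ ^ p

/-- The sum `S_n` of the first `n` terms of a sequence of random variables; the sequence is
indexed from `0`, so that `Xs i` is the `(i+1)`-st variable. -/
def partialSum {Ω B : Type*} [AddCommMonoid B] (Xs : ℕ → Ω → B) (n : ℕ) (ω : Ω) : B :=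
  ∑ i ∈ Finset.range n, Xs i ω

/-- The centering `γ_n = n E (X 1{‖X‖ ≤ b_n})`. -/
def truncCentering {Ω B : Type*} [MeasurableSpace Ω] [NormedAddCommGroup B] [NormedSpace ℝ B]
    (P : Measure Ω) (X : Ω → B) (b : ℕ → ℝ) (n : ℕ) : B :=
  (n : ℝ) • ∫ ω, {ω | ‖X ω‖ ≤ b n}.indicator X ω ∂P

end

/-! ### Variance of functions Lipschitz in each coordinate. -/

section EfronStein

variable {B : Type*} [NormedAddCommGroup B]

/-! Write `β n = b (n + 1)`. Suppose the series converges. Truncate the `i`-th variable at `β i`,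
divide by `β i` and centre. Over the dyadic block of indices `2 ^ k - 1, ..., 2 ^ (k + 1) - 2`, let
`M k` be the largest norm of a partial sum. If `M k → 0` almost surely, Abel summation inside blocks
and the growth of `β` between blocks make the weighted sums `o(β n)`
(`IsNorming.tendsto_norm_sum_smul_div`).

To get `M k → 0`, fluctuation and size are treated separately. By Efron–Stein, `Var (M k)` is at
most the sum of the second moments in the block. These are summable over all blocks because `p < 2`,
so `M k - E (M k) → 0` almost surely. Doob's inequality then reduces the claim to the mean norm of
the whole block sum. Here alone the type of the space enters: it bounds that mean uniformly in `k`,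
by a quantity that becomes small when the identity is approximated by simple functions. The simple
part involves finitely many vectors and is handled by scalar variances
(`IsNorming.tendsto_blockDeviation_id`).

Borel–Cantelli removes the truncation, and dominated convergence replaces the varying truncated
means by `γ_n`.

If the series diverges, it still diverges with `β` replaced by `K β`, and no deterministic shift of
the variables repairs this. By the second Borel–Cantelli lemma the increments of `S_n - γ_n` exceed
every multiple of `b_n` infinitely often. The two conclusions exclude each other, so both
implications become equivalences. -/

theorem continuous_of_abs_sub_le_sum_norm_sub {n : ℕ} {f : (Fin n → B) → ℝ}
    (hf : ∀ x y, |f x - f y| ≤ ∑ i, ‖x i - y i‖) : Continuous f := by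
  refine continuous_iff_continuousAt.2 fun x => ?_
  refine tendsto_iff_norm_sub_tendsto_zero.2 ?_
  refine squeeze_zero (fun _ => norm_nonneg _) (fun y => hf y x) ?_
  have : Continuous fun y : Fin n → B => ∑ i, ‖y i - x i‖ := by fun_prop
  simpa using this.tendsto x

variable [TopologicalSpace.SeparableSpace B] [MeasurableSpace B] [BorelSpace B]

theorem memLp_two_pi_of_abs_sub_le_sum_norm_sub {n : ℕ} {μ : Fin n → Measure B}
    [∀ i, IsProbabilityMeasure (μ i)] (hμ : ∀ i, MemLp id 2 (μ i)) {f : (Fin n → B) → ℝ}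
    (hf : ∀ x y, |f x - f y| ≤ ∑ i, ‖x i - y i‖) : MemLp f 2 (Measure.pi μ) := by
  have hc := continuous_of_abs_sub_le_sum_norm_sub hf
  have h1 : MemLp (fun x : Fin n → B => |f 0| + ∑ i, ‖x i‖) 2 (Measure.pi μ) := by
    have h2 : MemLp (fun _ : Fin n → B => |f 0|) 2 (Measure.pi μ) := memLp_const _
    have h3 : MemLp (fun x : Fin n → B => ∑ i, ‖x i‖) 2 (Measure.pi μ) :=
      memLp_finsetSum _ fun i _ =>
        ((hμ i).comp_measurePreserving (measurePreserving_eval μ i)).norm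
    exact h2.add h3
  refine h1.mono' hc.measurable.aestronglyMeasurable (ae_of_all _ fun x => ?_)
  have := hf x 0
  simp only [Pi.zero_apply, sub_zero] at this
  have h2 := abs_sub_abs_le_abs_sub (f x) (f 0)
  rw [Real.norm_eq_abs]; linarith

/-- **Efron–Stein inequality** for functions that are `1`-Lipschitz in each variable. -/
theorem variance_pi_le_sum_integral_norm_sq {n : ℕ} (μ : Fin n → Measure B)
    [∀ i, IsProbabilityMeasure (μ i)] (hμ : ∀ i, MemLp id 2 (μ i)) (f : (Fin n → B) → ℝ)
    (hf : ∀ x y, |f x - f y| ≤ ∑ i, ‖x i - y i‖) :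
    Var[f; Measure.pi μ] ≤ ∑ i, ∫ x, ‖x‖ ^ 2 ∂μ i := by
  induction n with
  | zero =>
    have : f = fun _ => f 0 := funext fun x => congrArg f (Subsingleton.elim _ _)
    rw [this]
    simp [variance_eq_integral]
  | succ n ih =>
    let ν : Measure (Fin n → B) := Measure.pi fun j => μ (Fin.succ j)
    let F : B × (Fin n → B) → ℝ := fun z => f (Fin.cons z.1 z.2)
    have hFl : ∀ a b x y, |F (a, x) - F (b, y)| ≤ ‖a - b‖ + ∑ i, ‖x i - y i‖ := by
      intro a b x y
      refine (hf _ _).trans_eq ?_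
      rw [Fin.sum_univ_succ]; simp
    have hmp := measurePreserving_piFinSuccAbove μ 0
    have hFf : f = F ∘ (MeasurableEquiv.piFinSuccAbove (fun _ => B) 0) := by
      funext x
      simp only [F, Function.comp, MeasurableEquiv.piFinSuccAbove]
      congr 1
      exact (Fin.cons_self_tail x).symm
    have hfL2 := memLp_two_pi_of_abs_sub_le_sum_norm_sub hμ hf
    have hcf := continuous_of_abs_sub_le_sum_norm_sub hf
    have hFc : Continuous F := hcf.comp (by fun_prop)
    have hFL2 : MemLp F 2 ((μ 0).prod ν) := by
      have hFe : F = f ∘ (MeasurableEquiv.piFinSuccAbove (fun _ => B) 0).symm := by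
        rw [hFf]; funext z; simp
      rw [hFe]
      exact hfL2.comp_measurePreserving (hmp.symm _)
    have hFa : ∀ x, MemLp (fun a => F (a, x)) 2 (μ 0) := by
      intro x
      have h1 : MemLp (fun _ : B => |F (0, x)|) 2 (μ 0) := memLp_const _
      have h2 : MemLp (fun a : B => ‖a‖) 2 (μ 0) := (hμ 0).norm
      have h3 : Continuous fun a => F (a, x) := by fun_prop
      refine (h1.add h2).mono' h3.measurable.aestronglyMeasurable (ae_of_all _ fun a => ?_)
      have := hFl a 0 x x
      simp only [sub_zero, sub_self, norm_zero, Finset.sum_const_zero, add_zero] at this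
      have h2 := abs_sub_abs_le_abs_sub (F (a, x)) (F (0, x))
      simp only [Real.norm_eq_abs, Pi.add_apply]; linarith
    have hFint : ∀ x, Integrable (fun a => F (a, x)) (μ 0) := fun x =>
      (hFa x).integrable (by norm_num)
    let g : (Fin n → B) → ℝ := fun x => ∫ a, F (a, x) ∂μ 0
    have hg : ∀ x y, |g x - g y| ≤ ∑ i, ‖x i - y i‖ := by
      intro x y
      simp only [g]
      rw [← integral_sub (hFint x) (hFint y), ← Real.norm_eq_abs]
      refine (norm_integral_le_of_norm_le_const (C := ∑ i, ‖x i - y i‖)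
        (ae_of_all _ fun a => ?_)).trans_eq (by simp)
      simpa using hFl a a x y
    have hgν := ih (fun j => μ (Fin.succ j)) (fun j => hμ _) g hg
    have hgL2 : MemLp g 2 ν := memLp_two_pi_of_abs_sub_le_sum_norm_sub (fun j => hμ _) hg
    have hV : Var[f; Measure.pi μ] = Var[F; (μ 0).prod ν] := by
      rw [hFf]
      exact hmp.variance_fun_comp hFc.measurable.aemeasurable
    rw [hV, variance_eq_integral hFc.measurable.aemeasurable, Fin.sum_univ_succ]
    have hFi : Integrable F ((μ 0).prod ν) := hFL2.integrable (by norm_num)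
    set m := ∫ z, F z ∂((μ 0).prod ν) with hm
    have hmg : m = ∫ x, g x ∂ν := integral_prod_symm _ hFi
    have hsq : Integrable (fun z => (F z - m) ^ 2) ((μ 0).prod ν) :=
      (hFL2.sub (memLp_const m)).integrable_sq
    rw [integral_prod_symm _ hsq]
    -- For fixed `x`, the second moment about `m` is the variance in `a`, controlled by comparing
    -- with `a = 0`, plus `(g x - m) ^ 2`. Integrated over `x`, the latter is `Var g`, and `g`
    -- inherits the Lipschitz bound.
    have key : ∀ x, ∫ a, (F (a, x) - m) ^ 2 ∂μ 0 ≤ (∫ a, ‖a‖ ^ 2 ∂μ 0) + (g x - m) ^ 2 := by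
      intro x
      have e1 : Var[fun a => F (a, x); μ 0] ≤ ∫ a, ‖a‖ ^ 2 ∂μ 0 := by
        rw [← variance_sub_const (hFa x).aestronglyMeasurable (F (0, x))]
        refine (variance_le_expectation_sq ?_).trans ?_
        · exact ((hFa x).sub (memLp_const _)).aestronglyMeasurable
        · refine integral_mono ((hFa x).sub (memLp_const _)).integrable_sq
            (hμ 0).norm.integrable_sq fun a => ?_
          have := hFl a 0 x x
          simp only [sub_zero, sub_self, norm_zero, Finset.sum_const_zero, add_zero] at this
          simpa [g] using sq_le_sq' (by linarith [neg_abs_le (F (a, x) - F (0, x))])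
            ((le_abs_self _).trans this)
      have e2 := variance_eq_sub (X := fun a => F (a, x) - m) ((hFa x).sub (memLp_const m))
      rw [variance_sub_const (hFa x).aestronglyMeasurable m] at e2
      have e4 : ∫ a, (F (a, x) - m) ∂μ 0 = g x - m := by
        rw [integral_sub (hFint x) (integrable_const _)]; simp [g]
      rw [e4] at e2
      simp only [Pi.pow_apply] at e2
      linarith
    have hgs : Integrable (fun x => (g x - m) ^ 2) ν := (hgL2.sub (memLp_const m)).integrable_sq
    calc _ ≤ ∫ x, ((∫ a, ‖a‖ ^ 2 ∂μ 0) + (g x - m) ^ 2) ∂ν :=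
          integral_mono hsq.integral_prod_right ((integrable_const _).add hgs) key
      _ = (∫ a, ‖a‖ ^ 2 ∂μ 0) + Var[g; ν] := by
          rw [integral_add (integrable_const _) hgs, variance_eq_integral
            hgL2.aestronglyMeasurable.aemeasurable, hmg]; simp
      _ ≤ _ := by gcongr

end EfronStein

/-! ### Maximal partial sums: variance bound and Doob's inequality. -/

section MaximalPartialSum

variable {B : Type*} [NormedAddCommGroup B]

/-- The largest norm of the partial sums `∑ i ≤ n, u i` with `n ≤ N`. -/
noncomputable def maxPartialSum (u : ℕ → B) (N : ℕ) : ℝ :=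
  (Finset.range (N + 1)).sup' Finset.nonempty_range_add_one
    fun k => ‖∑ i ∈ Finset.range (k + 1), u i‖

theorem norm_sum_le_maxPartialSum (u : ℕ → B) {k N : ℕ} (hk : k ≤ N) :
    ‖∑ i ∈ Finset.range (k + 1), u i‖ ≤ maxPartialSum u N :=
  Finset.le_sup' (fun k => ‖∑ i ∈ Finset.range (k + 1), u i‖) (by simp; omega)

theorem maxPartialSum_nonneg (u : ℕ → B) (N : ℕ) : 0 ≤ maxPartialSum u N :=
  (norm_nonneg _).trans (norm_sum_le_maxPartialSum u (Nat.zero_le N))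

theorem maxPartialSum_le_add (u v : ℕ → B) (N : ℕ) :
    maxPartialSum u N ≤ maxPartialSum v N + ∑ i ∈ Finset.range (N + 1), ‖u i - v i‖ := by
  refine Finset.sup'_le _ _ fun k hk => ?_
  have hkN : k ≤ N := by simp at hk; omega
  have h1 : ∑ i ∈ Finset.range (k + 1), u i =
      ∑ i ∈ Finset.range (k + 1), v i + ∑ i ∈ Finset.range (k + 1), (u i - v i) := by
    rw [← Finset.sum_add_distrib]; simp
  rw [h1]
  refine (norm_add_le _ _).trans (add_le_add (norm_sum_le_maxPartialSum v hkN) ?_)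
  refine (norm_sum_le _ _).trans ?_
  refine Finset.sum_le_sum_of_subset_of_nonneg ?_ fun _ _ _ => norm_nonneg _
  exact Finset.range_mono (by omega)

theorem abs_maxPartialSum_sub_le (u v : ℕ → B) (N : ℕ) :
    |maxPartialSum u N - maxPartialSum v N| ≤ ∑ i ∈ Finset.range (N + 1), ‖u i - v i‖ := by
  have h1 := maxPartialSum_le_add u v N
  have h2 := maxPartialSum_le_add v u N
  simp only [norm_sub_rev (v _)] at h2
  rw [abs_le]; constructor <;> linarith

variable [TopologicalSpace.SeparableSpace B] [MeasurableSpace B] [BorelSpace B]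
  {Ω : Type*} [MeasurableSpace Ω] {P : Measure Ω} [IsProbabilityMeasure P]

/-- The maximum is `1`-Lipschitz in each summand, and a deterministic shift `c` preserves this.
Hence centring does not affect the bound. -/
theorem variance_maxPartialSum_le {Z : ℕ → Ω → B} (hZ : ∀ i, Measurable (Z i))
    (hind : iIndepFun Z P) (hL2 : ∀ i, MemLp (Z i) 2 P) (c : ℕ → B) (N : ℕ) :
    Var[fun ω => maxPartialSum (fun i => Z i ω - c i) N; P] ≤
        ∑ i ∈ Finset.range (N + 1), ∫ ω, ‖Z i ω‖ ^ 2 ∂P ∧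
      MemLp (fun ω => maxPartialSum (fun i => Z i ω - c i) N) 2 P := by
  let ext : (Fin (N + 1) → B) → ℕ → B := fun x i => if h : i < N + 1 then x ⟨i, h⟩ - c i else 0
  let f : (Fin (N + 1) → B) → ℝ := fun x => maxPartialSum (ext x) N
  have hf : ∀ x y, |f x - f y| ≤ ∑ i, ‖x i - y i‖ := by
    intro x y
    refine (abs_maxPartialSum_sub_le _ _ _).trans_eq ?_
    rw [Finset.sum_range]
    refine Finset.sum_congr rfl fun i _ => ?_
    have := i.is_le
    simp [ext, this]
  let Φ : Ω → Fin (N + 1) → B := fun ω i => Z i ω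
  have hΦ : Measurable Φ := measurable_pi_lambda _ fun i => hZ i
  have hmap : P.map Φ = Measure.pi fun i : Fin (N + 1) => P.map (Z i) :=
    (iIndepFun_iff_map_fun_eq_pi_map (f := fun i : Fin (N + 1) => Z i)
      fun i => (hZ i).aemeasurable).1 (hind.precomp Fin.val_injective)
  have hfΦ : (fun ω => maxPartialSum (fun i => Z i ω - c i) N) = f ∘ Φ := by
    funext ω
    simp only [f, Function.comp, maxPartialSum]
    refine Finset.sup'_congr _ rfl fun k hk => ?_
    congr 1
    refine Finset.sum_congr rfl fun i hi => ?_
    have : i ≤ N := by simp at hk hi; omega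
    simp [ext, Φ, this]
  have : ∀ i : Fin (N + 1), IsProbabilityMeasure (P.map (Z i)) := fun i =>
    Measure.isProbabilityMeasure_map (hZ i).aemeasurable
  have hL : ∀ i : Fin (N + 1), MemLp id 2 (P.map (Z i)) := fun i =>
    (memLp_map_measure_iff aestronglyMeasurable_id (hZ i).aemeasurable).2 (hL2 i)
  have hfc := continuous_of_abs_sub_le_sum_norm_sub hf
  rw [hfΦ]
  constructor
  · rw [← variance_map hfc.measurable.aemeasurable hΦ.aemeasurable, hmap]
    refine (variance_pi_le_sum_integral_norm_sq _ hL f hf).trans_eq ?_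
    rw [Finset.sum_range]
    refine Finset.sum_congr rfl fun i _ => ?_
    rw [integral_map (hZ i).aemeasurable]
    exact (by fun_prop : Continuous fun x : B => ‖x‖ ^ 2).measurable.aestronglyMeasurable
  · have := memLp_two_pi_of_abs_sub_le_sum_norm_sub hL hf
    rw [← hmap] at this
    exact (memLp_map_measure_iff hfc.measurable.aestronglyMeasurable hΦ.aemeasurable).1 this

variable [NormedSpace ℝ B] [CompleteSpace B]

/-- Since `V` is independent of `U` and centred, `U` is the conditional expectation of `U + V` given
`U`; conditional expectation contracts the mean norm. -/
theorem integral_norm_le_integral_norm_add {U V : Ω → B} (hU : Measurable U) (hV : Measurable V)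
    (hUi : Integrable U P) (hVi : Integrable V P) (hind : IndepFun U V P) (hV0 : ∫ ω, V ω ∂P = 0) :
    ∫ ω, ‖U ω‖ ∂P ≤ ∫ ω, ‖U ω + V ω‖ ∂P := by
  have hm := hU.comap_le
  have h1 : P[V | MeasurableSpace.comap U inferInstance] =ᵐ[P] fun _ => ∫ ω, V ω ∂P :=
    condExp_indep_eq hV.comap_le hm (comap_measurable V).stronglyMeasurable hind.symm
  have h2 : P[U | MeasurableSpace.comap U inferInstance] = U :=
    condExp_of_stronglyMeasurable hm (comap_measurable U).stronglyMeasurable hUi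
  have h3 := condExp_add hUi hVi (MeasurableSpace.comap U inferInstance)
  have h4 := norm_condExp_le (m := MeasurableSpace.comap U inferInstance) (μ := P)
    (fun ω => U ω + V ω)
  rw [← integral_condExp (f := fun ω => ‖U ω + V ω‖) hm]
  refine integral_mono_ae hUi.norm integrable_condExp ?_
  filter_upwards [h1, h3, h4] with ω a1 a3 a4
  refine le_trans (le_of_eq ?_) a4
  have : P[fun ω => U ω + V ω | MeasurableSpace.comap U inferInstance] ω = U ω := by
    refine a3.trans ?_
    rw [Pi.add_apply, a1, h2, hV0, add_zero]
  simp only [this]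

theorem submartingale_norm_sum {Z : ℕ → Ω → B} (hZ : ∀ i, Measurable (Z i))
    (hind : iIndepFun Z P) (hint : ∀ i, Integrable (Z i) P) (h0 : ∀ i, ∫ ω, Z i ω ∂P = 0) :
    Submartingale (fun n ω => ‖∑ i ∈ Finset.range (n + 1), Z i ω‖)
      (Filtration.natural Z fun i => (hZ i).stronglyMeasurable) P := by
  set 𝓕 := Filtration.natural Z fun i => (hZ i).stronglyMeasurable with h𝓕
  have hS : ∀ n, StronglyMeasurable[𝓕 n] fun ω => ∑ i ∈ Finset.range (n + 1), Z i ω := by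
    intro n
    refine Finset.stronglyMeasurable_fun_sum _ fun i hi => ?_
    exact (Filtration.stronglyAdapted_natural (fun i => (hZ i).stronglyMeasurable) i).mono
      (𝓕.mono (by simp at hi; omega))
  have hSi : ∀ n, Integrable (fun ω => ∑ i ∈ Finset.range (n + 1), Z i ω) P :=
    fun n => integrable_finsetSum _ fun i _ => hint i
  refine submartingale_nat (fun n => (hS n).norm) (fun n => (hSi n).norm) fun n => ?_
  have h1 := hind.condExp_natural_ae_eq_of_lt (fun i => (hZ i).stronglyMeasurable)
    (Nat.lt_succ_self n)
  have h2 : P[fun ω => ∑ i ∈ Finset.range (n + 1), Z i ω | 𝓕 n] =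
      fun ω => ∑ i ∈ Finset.range (n + 1), Z i ω :=
    condExp_of_stronglyMeasurable (𝓕.le n) (hS n) (hSi n)
  have h3 := condExp_add (hSi n) (hint (n + 1)) (𝓕 n)
  have h4 := norm_condExp_le (m := 𝓕 n) (μ := P) (fun ω => ∑ i ∈ Finset.range (n + 1 + 1), Z i ω)
  filter_upwards [h1, h3, h4] with ω a1 a3 a4
  refine le_trans (le_of_eq ?_) a4
  have : P[fun ω => ∑ i ∈ Finset.range (n + 1 + 1), Z i ω | 𝓕 n] ω =
      ∑ i ∈ Finset.range (n + 1), Z i ω := by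
    have e : (fun ω => ∑ i ∈ Finset.range (n + 1 + 1), Z i ω) =
        (fun ω => ∑ i ∈ Finset.range (n + 1), Z i ω) + Z (n + 1) := by
      funext ω; rw [Finset.sum_range_succ]; rfl
    rw [e, a3, Pi.add_apply, h2, a1, h0, add_zero]
  rw [this]

/-- **Doob's weak maximal inequality** for sums of independent centred vectors. -/
theorem mul_measure_le_maxPartialSum {Z : ℕ → Ω → B} (hZ : ∀ i, Measurable (Z i))
    (hind : iIndepFun Z P) (hint : ∀ i, Integrable (Z i) P) (h0 : ∀ i, ∫ ω, Z i ω ∂P = 0)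
    (ε : ℝ≥0) (N : ℕ) :
    ε * P {ω | (ε : ℝ) ≤ maxPartialSum (fun i => Z i ω) N} ≤
      ENNReal.ofReal (∫ ω, ‖∑ i ∈ Finset.range (N + 1), Z i ω‖ ∂P) := by
  refine (maximal_ineq (submartingale_norm_sum hZ hind hint h0)
    (fun n ω => norm_nonneg _) N).trans ?_
  refine ENNReal.ofReal_le_ofReal (setIntegral_le_integral ?_ (ae_of_all _ fun ω => norm_nonneg _))
  exact (integrable_finsetSum _ fun i _ => hint i).norm

end MaximalPartialSum

/-! ### From random signs to independent centred vectors. -/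

section RademacherType

instance : IsProbabilityMeasure rademacherMeasure := by
  unfold rademacherMeasure; infer_instance

theorem ae_rademacherMeasure_sign : ∀ᵐ r ∂rademacherMeasure, ∀ n, r n = 1 ∨ r n = -1 := by
  refine ae_all_iff.2 fun n => ?_
  have h1 : ∀ᵐ x ∂rademacherLaw, x = 1 ∨ x = -1 := by
    unfold rademacherLaw
    rw [ae_add_measure_iff]
    constructor <;> refine Measure.ae_smul_measure ?_ _ <;> simp [ae_dirac_eq]
  exact (measurePreserving_eval_infinitePi (fun _ : ℕ => rademacherLaw) n).quasiMeasurePreserving.ae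
    h1

theorem lintegral_le_rpow_lintegral_rpow {α : Type*} [MeasurableSpace α] {μ : Measure α}
    [IsProbabilityMeasure μ] {f : α → ℝ≥0∞} (hf : Measurable f) {p : ℝ} (hp : 1 ≤ p) :
    ∫⁻ x, f x ∂μ ≤ (∫⁻ x, f x ^ p ∂μ) ^ (1 / p) := by
  have := eLpNorm'_le_eLpNorm'_of_exponent_le one_pos hp μ hf.aestronglyMeasurable
  simpa [eLpNorm'] using this

variable {B : Type*} [NormedAddCommGroup B] [NormedSpace ℝ B]
  [TopologicalSpace.SeparableSpace B]

/-- Padding a finite family with zeros makes the partial sums eventually constant, so convergence in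
probability is automatic. -/
theorem IsRademacherType.exists_lintegral_sum_range_le {p : ℝ} (hp : 1 ≤ p)
    (hB : IsRademacherType B p) :
    ∃ C : ℝ≥0, ∀ (n : ℕ) (v : ℕ → B),
      ∫⁻ r, ‖∑ i ∈ Finset.range n, r i • v i‖ₑ ^ p ∂rademacherMeasure ≤
        C * ∑ i ∈ Finset.range n, ‖v i‖ₑ ^ p := by
  obtain ⟨C, -, hC⟩ := hB
  refine ⟨C, fun n v => ?_⟩
  let w : ℕ → B := fun i => if i < n then v i else 0
  have hsum : ∀ N, n ≤ N → ∀ r : ℕ → ℝ, ∑ i ∈ Finset.range N, r i • w i =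
      ∑ i ∈ Finset.range n, r i • v i := by
    intro N hN r
    rw [← Finset.sum_subset (Finset.range_mono hN)]
    · exact Finset.sum_congr rfl fun i hi => by simp [w, Finset.mem_range.1 hi]
    · intro i _ hi
      simp [w, Finset.mem_range] at hi ⊢
      intro h; omega
  have hT : StronglyMeasurable fun r : ℕ → ℝ => ∑ i ∈ Finset.range n, r i • v i := by
    have : Continuous fun r : ℕ → ℝ => ∑ i ∈ Finset.range n, r i • v i := by fun_prop
    exact this.stronglyMeasurable
  have hlim : TendstoInMeasure rademacherMeasure
      (fun (N : ℕ) (r : ℕ → ℝ) => ∑ n ∈ Finset.range N, r n • w n) atTop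
      (fun r : ℕ → ℝ => ∑ i ∈ Finset.range n, r i • v i) := by
    intro ε hε
    refine tendsto_const_nhds.congr' ?_
    filter_upwards [eventually_ge_atTop n] with N hN
    simp [hsum N hN, hε.ne']
  refine (hC w _ hT hlim).trans_eq ?_
  congr 1
  rw [tsum_eq_sum (s := Finset.range n)]
  · exact Finset.sum_congr rfl fun i hi => by simp [w, Finset.mem_range.1 hi]
  · intro i hi
    have : 0 < p := by linarith
    simp only [Finset.mem_range] at hi
    simp [w, hi, this]

variable [CompleteSpace B] [MeasurableSpace B] [BorelSpace B]
  {Ω : Type*} [MeasurableSpace Ω] {P : Measure Ω} [IsProbabilityMeasure P]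

/-- Group the terms by sign into independent centred sums `U` and `V`. Each of `E ‖U‖` and `E ‖V‖`
is at most `E ‖U - V‖`, whence the factor `2`. No independent copy is needed. -/
theorem integral_norm_sum_le_two_mul_signed {Z : ℕ → Ω → B} (hZ : ∀ i, Measurable (Z i))
    (hind : iIndepFun Z P) (hint : ∀ i, Integrable (Z i) P) (h0 : ∀ i, ∫ ω, Z i ω ∂P = 0)
    {r : ℕ → ℝ} (hr : ∀ i, r i = 1 ∨ r i = -1) (n : ℕ) :
    ∫ ω, ‖∑ i ∈ Finset.range n, Z i ω‖ ∂P ≤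
      2 * ∫ ω, ‖∑ i ∈ Finset.range n, r i • Z i ω‖ ∂P := by
  classical
  let A := (Finset.range n).filter fun i => r i = 1
  let A' := (Finset.range n).filter fun i => ¬ r i = 1
  have hdisj : Disjoint A A' := Finset.disjoint_filter_filter_not _ _ _
  let U : Ω → B := fun ω => ∑ i ∈ A, Z i ω
  let V : Ω → B := fun ω => ∑ i ∈ A', Z i ω
  have hUm : Measurable U := Finset.measurable_fun_sum _ fun i _ => hZ i
  have hVm : Measurable V := Finset.measurable_fun_sum _ fun i _ => hZ i
  have hUi : Integrable U P := integrable_finsetSum _ fun i _ => hint i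
  have hVi : Integrable V P := integrable_finsetSum _ fun i _ => hint i
  have hU0 : ∫ ω, U ω ∂P = 0 := by
    simp only [U]; rw [integral_finsetSum _ fun i _ => hint i]; simp [h0]
  have hV0 : ∫ ω, V ω ∂P = 0 := by
    simp only [V]; rw [integral_finsetSum _ fun i _ => hint i]; simp [h0]
  have hUV : IndepFun U V P := by
    have h1 := hind.indepFun_finset A A' hdisj hZ
    have h2 := h1.comp (φ := fun x : A → B => ∑ i, x i) (ψ := fun x : A' → B => ∑ i, x i)
      (by fun_prop) (by fun_prop)
    convert h2 using 1
    · funext ω; exact (Finset.sum_coe_sort A fun i => Z i ω).symm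
    · funext ω; exact (Finset.sum_coe_sort A' fun i => Z i ω).symm
  have hsum : ∀ ω, ∑ i ∈ Finset.range n, Z i ω = U ω + V ω := fun ω =>
    (Finset.sum_filter_add_sum_filter_not _ _ _).symm
  have hsgn : ∀ ω, ∑ i ∈ Finset.range n, r i • Z i ω = U ω + -V ω := by
    intro ω
    rw [← Finset.sum_filter_add_sum_filter_not _ (fun i => r i = 1)]
    congr 1
    · exact Finset.sum_congr rfl fun i hi => by rw [(Finset.mem_filter.1 hi).2, one_smul]
    · simp only [V]
      rw [← Finset.sum_neg_distrib]
      refine Finset.sum_congr rfl fun i hi => ?_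
      rw [(hr i).resolve_left (Finset.mem_filter.1 hi).2, neg_one_smul]
  simp only [hsum, hsgn]
  have e1 : ∫ ω, ‖U ω‖ ∂P ≤ ∫ ω, ‖U ω + -V ω‖ ∂P := by
    refine integral_norm_le_integral_norm_add hUm hVm.neg hUi hVi.neg
      (hUV.comp measurable_id measurable_neg) ?_
    rw [integral_neg, hV0, neg_zero]
  have e2 : ∫ ω, ‖V ω‖ ∂P ≤ ∫ ω, ‖U ω + -V ω‖ ∂P := by
    have := integral_norm_le_integral_norm_add hVm hUm.neg hVi hUi.neg
      (hUV.symm.comp measurable_id measurable_neg) (by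
        simp only [Pi.neg_apply]; rw [integral_neg, hU0, neg_zero])
    refine this.trans_eq (integral_congr_ae (ae_of_all _ fun ω => ?_))
    simp only [Pi.neg_apply]
    rw [← norm_neg]; congr 1; abel
  calc ∫ ω, ‖U ω + V ω‖ ∂P ≤ ∫ ω, (‖U ω‖ + ‖V ω‖) ∂P :=
        integral_mono (hUi.add hVi).norm (hUi.norm.add hVi.norm) fun ω => norm_add_le _ _
    _ = ∫ ω, ‖U ω‖ ∂P + ∫ ω, ‖V ω‖ ∂P := integral_add hUi.norm hVi.norm
    _ ≤ _ := by linarith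

/-- In a space of Rademacher type `p`, the mean norm of a sum of independent centred vectors is
controlled by their `p`-th moments. -/
theorem IsRademacherType.exists_lintegral_norm_sum_le {p : ℝ} (hp : 1 ≤ p)
    (hB : IsRademacherType B p) :
    ∃ C : ℝ≥0, ∀ (Z : ℕ → Ω → B), (∀ i, Measurable (Z i)) → iIndepFun Z P →
      (∀ i, Integrable (Z i) P) → (∀ i, ∫ ω, Z i ω ∂P = 0) → ∀ n : ℕ,
      ∫⁻ ω, ‖∑ i ∈ Finset.range n, Z i ω‖ₑ ∂P ≤
        2 * (C * ∑ i ∈ Finset.range n, ∫⁻ ω, ‖Z i ω‖ₑ ^ p ∂P) ^ (1 / p) := by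
  obtain ⟨C, hC⟩ := hB.exists_lintegral_sum_range_le hp
  refine ⟨C, fun Z hZ hind hint h0 n => ?_⟩
  have hp0 : 0 < p := by linarith
  have hmeas : Measurable fun z : (ℕ → ℝ) × Ω => ‖∑ i ∈ Finset.range n, z.1 i • Z i z.2‖ₑ := by
    refine Measurable.enorm (Finset.measurable_fun_sum _ fun i _ => ?_)
    exact Measurable.smul (by fun_prop) ((hZ i).comp measurable_snd)
  have h1 : ∀ᵐ r ∂rademacherMeasure, ∫⁻ ω, ‖∑ i ∈ Finset.range n, Z i ω‖ₑ ∂P ≤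
      2 * ∫⁻ ω, ‖∑ i ∈ Finset.range n, r i • Z i ω‖ₑ ∂P := by
    filter_upwards [ae_rademacherMeasure_sign] with r hr
    have i1 : Integrable (fun ω => ∑ i ∈ Finset.range n, Z i ω) P :=
      integrable_finsetSum _ fun i _ => hint i
    have i2 : Integrable (fun ω => ∑ i ∈ Finset.range n, r i • Z i ω) P :=
      integrable_finsetSum _ fun i _ => (hint i).smul (r i)
    rw [← ofReal_integral_norm_eq_lintegral_enorm i1, ← ofReal_integral_norm_eq_lintegral_enorm i2]
    have := integral_norm_sum_le_two_mul_signed hZ hind hint h0 hr n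
    refine (ENNReal.ofReal_le_ofReal this).trans_eq ?_
    rw [ENNReal.ofReal_mul (by norm_num)]; simp
  -- The bound holds for almost every choice of signs, so it may be averaged over them. After
  -- Tonelli, the type inequality applies to the frozen vectors `Z i ω`, with Jensen used once for
  -- each measure.
  calc ∫⁻ ω, ‖∑ i ∈ Finset.range n, Z i ω‖ₑ ∂P
      = ∫⁻ _, (∫⁻ ω, ‖∑ i ∈ Finset.range n, Z i ω‖ₑ ∂P) ∂rademacherMeasure := by simp
    _ ≤ ∫⁻ r, 2 * (∫⁻ ω, ‖∑ i ∈ Finset.range n, r i • Z i ω‖ₑ ∂P) ∂rademacherMeasure :=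
        lintegral_mono_ae h1
    _ = 2 * ∫⁻ r, (∫⁻ ω, ‖∑ i ∈ Finset.range n, r i • Z i ω‖ₑ ∂P) ∂rademacherMeasure :=
        lintegral_const_mul _ hmeas.lintegral_prod_right'
    _ = 2 * ∫⁻ ω, (∫⁻ r, ‖∑ i ∈ Finset.range n, r i • Z i ω‖ₑ ∂rademacherMeasure) ∂P := by
        rw [lintegral_lintegral_swap hmeas.aemeasurable]
    _ ≤ 2 * ∫⁻ ω, (C * ∑ i ∈ Finset.range n, ‖Z i ω‖ₑ ^ p) ^ (1 / p) ∂P := by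
        gcongr with ω
        refine (lintegral_le_rpow_lintegral_rpow ?_ hp).trans ?_
        · exact hmeas.comp (measurable_id.prodMk measurable_const)
        · gcongr
          exact hC n fun i => Z i ω
    _ ≤ 2 * (∫⁻ ω, ((C * ∑ i ∈ Finset.range n, ‖Z i ω‖ₑ ^ p) ^ (1 / p)) ^ p ∂P) ^ (1 / p) := by
        gcongr
        refine lintegral_le_rpow_lintegral_rpow ?_ hp
        fun_prop
    _ = _ := by
        simp_rw [← ENNReal.rpow_mul, one_div, inv_mul_cancel₀ hp0.ne', ENNReal.rpow_one]
        rw [lintegral_const_mul _ (by fun_prop), lintegral_finsetSum _ (by fun_prop)]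

end RademacherType

/-! ### Norming sequences and their counting function. -/

section Norming

/-- Each quotient arises from exactly `m + 1` values of `k`. -/
theorem ENNReal.tsum_comp_div (f : ℕ → ℝ≥0∞) (m : ℕ) :
    ∑' k : ℕ, f (k / (m + 1)) = (∑' j, f j) * (m + 1) := by
  calc _ = ∑' z : ℕ × Fin (m + 1), f z.1 := by
        rw [← (Nat.divModEquiv (m + 1)).tsum_eq]
        rfl
    _ = _ := by
        rw [ENNReal.tsum_prod']
        simp only [tsum_fintype, Finset.sum_const, Finset.card_univ, Fintype.card_fin, nsmul_eq_mul]
        rw [ENNReal.tsum_mul_left, mul_comm]; push_cast; rfl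

/-- A positive sequence `β` such that `β n / (n + 1) ^ (1 / p)` is nondecreasing. -/
structure IsNorming (p : ℝ) (β : ℕ → ℝ) : Prop where
  pos : ∀ n, 0 < β n
  div_le : ∀ m n, m ≤ n → β m / ((m : ℝ) + 1) ^ (1 / p) ≤ β n / ((n : ℝ) + 1) ^ (1 / p)

/-- The number of indices `k` with `β k < x`. -/
noncomputable def countBelow (β : ℕ → ℝ) (x : ℝ) : ℝ≥0∞ := ∑' k, if β k < x then 1 else 0

theorem measurable_countBelow (β : ℕ → ℝ) : Measurable (countBelow β) :=
  Measurable.tsum fun _ =>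
    Measurable.ite (measurableSet_lt measurable_const measurable_id) measurable_const
      measurable_const

/-- Tonelli. Convergence of the series thus becomes integrability of `countBelow β ‖X‖`, which
serves as the dominating function below. -/
theorem lintegral_countBelow_norm {B Ω : Type*} [NormedAddCommGroup B] [MeasurableSpace B]
    [BorelSpace B] [MeasurableSpace Ω] {P : Measure Ω} {X : Ω → B} (hX : Measurable X)
    (β : ℕ → ℝ) :
    ∫⁻ ω, countBelow β ‖X ω‖ ∂P = ∑' n, P {ω | β n < ‖X ω‖} := by
  have hm : ∀ n, MeasurableSet {ω | β n < ‖X ω‖} := fun n =>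
    measurableSet_lt measurable_const hX.norm
  simp only [countBelow]
  rw [lintegral_tsum fun n =>
    (Measurable.ite (hm n) measurable_const measurable_const).aemeasurable]
  congr 1; funext n
  rw [← lintegral_indicator_one (hm n)]
  rfl

theorem natCast_le_countBelow {β : ℕ → ℝ} {x : ℝ} {m : ℕ} (h : ∀ k < m, β k < x) :
    (m : ℝ≥0∞) ≤ countBelow β x := by
  refine le_trans (le_of_eq ?_) (ENNReal.sum_le_tsum (Finset.range m))
  rw [Finset.sum_congr rfl fun k hk => if_pos (h k (Finset.mem_range.1 hk))]
  simp

theorem exists_first_le {β : ℕ → ℝ} {x : ℝ} {n : ℕ} (hx : x ≤ β n) :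
    ∃ m : ℕ, (∀ k, x ≤ β k → m ≤ k) ∧ x ≤ β m ∧ (m : ℝ≥0∞) ≤ countBelow β x := by
  classical
  have hex : ∃ k, x ≤ β k := ⟨n, hx⟩
  exact ⟨Nat.find hex, fun k hk => Nat.find_min' hex hk, Nat.find_spec hex,
    natCast_le_countBelow fun k hk => not_le.1 (Nat.find_min hex hk)⟩

namespace IsNorming

variable {p : ℝ} {β : ℕ → ℝ}

theorem div_le_rpow (h : IsNorming p β) {m n : ℕ} (hmn : m ≤ n) :
    β m / β n ≤ (((m : ℝ) + 1) / ((n : ℝ) + 1)) ^ (1 / p) := by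
  have hm : (0 : ℝ) < ((m : ℝ) + 1) ^ (1 / p) := by positivity
  have hn : (0 : ℝ) < ((n : ℝ) + 1) ^ (1 / p) := by positivity
  have h1 := h.div_le m n hmn
  rw [Real.div_rpow (by positivity) (by positivity), div_le_div_iff₀ (h.pos n) hn]
  rw [div_le_div_iff₀ hm hn] at h1
  linarith

theorem div_le_one (h : IsNorming p β) (hp : 0 < p) {m n : ℕ} (hmn : m ≤ n) :
    β m / β n ≤ 1 := by
  refine (h.div_le_rpow hmn).trans (Real.rpow_le_one (by positivity) ?_ (by positivity))
  rw [div_le_one₀ (by positivity)]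
  have : (m : ℝ) ≤ n := by exact_mod_cast hmn
  linarith

theorem monotone (h : IsNorming p β) (hp : 0 < p) : Monotone β := fun _ n hmn =>
  (div_le_one₀ (h.pos n)).1 (h.div_le_one hp hmn)

theorem mul_rpow_le (h : IsNorming p β) (n : ℕ) : β 0 * ((n : ℝ) + 1) ^ (1 / p) ≤ β n := by
  have h1 := h.div_le 0 n (Nat.zero_le n)
  simp only [CharP.cast_eq_zero, zero_add, Real.one_rpow, div_one] at h1
  rwa [le_div_iff₀ (by positivity)] at h1

theorem tendsto_atTop (h : IsNorming p β) (hp : 0 < p) : Tendsto β atTop atTop := by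
  refine tendsto_atTop_mono h.mul_rpow_le ?_
  refine Tendsto.const_mul_atTop (h.pos 0) ?_
  refine (tendsto_rpow_atTop (by positivity)).comp ?_
  exact tendsto_atTop_add_const_right _ _ tendsto_natCast_atTop_atTop

theorem summable_inv_sq (h : IsNorming p β) (hp : 0 < p) (hp2 : p < 2) :
    Summable fun n => ((β n)⁻¹) ^ 2 := by
  have h1 : Summable fun n : ℕ => ((β 0)⁻¹) ^ 2 * (((n + 1 : ℕ) : ℝ) ^ (2 / p))⁻¹ := by
    refine Summable.mul_left _ ?_
    refine (summable_nat_add_iff (f := fun n : ℕ => ((n : ℝ) ^ (2 / p))⁻¹) 1).2 ?_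
    exact Real.summable_nat_rpow_inv.2 ((one_lt_div hp).2 hp2)
  refine h1.of_nonneg_of_le (fun n => by positivity) fun n => ?_
  have h2 := h.mul_rpow_le n
  have h0 := h.pos 0
  have e : ((n + 1 : ℕ) : ℝ) ^ (2 / p) = (((n : ℝ) + 1) ^ (1 / p)) ^ 2 := by
    rw [← Real.rpow_natCast, ← Real.rpow_mul (by positivity)]
    push_cast; congr 1; ring
  have hn := h.pos n
  rw [e, ← inv_pow, ← mul_pow, ← mul_inv]
  gcongr

theorem ofReal_mul_rpow_le_countBelow (h : IsNorming p β) (hp : 0 < p) {x : ℝ} (hx0 : 0 ≤ x)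
    {n : ℕ} (hx : x ≤ β n) :
    ENNReal.ofReal (((n : ℝ) + 1) * (x / β n) ^ p) ≤ countBelow β x + 1 := by
  obtain ⟨m, hm1, hm2, hm3⟩ := exists_first_le hx
  have hmn := hm1 n hx
  have hn := h.pos n
  have h1 : (x / β n) ^ p ≤ ((m : ℝ) + 1) / ((n : ℝ) + 1) := by
    calc (x / β n) ^ p ≤ ((((m : ℝ) + 1) / ((n : ℝ) + 1)) ^ (1 / p)) ^ p := by
          refine Real.rpow_le_rpow (by positivity) (le_trans ?_ (h.div_le_rpow hmn)) hp.le
          gcongr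
      _ = _ := by
          rw [← Real.rpow_mul (by positivity), one_div, inv_mul_cancel₀ hp.ne', Real.rpow_one]
  have h2 : ((n : ℝ) + 1) * (x / β n) ^ p ≤ ((m + 1 : ℕ) : ℝ) := by
    rw [le_div_iff₀ (by positivity)] at h1
    push_cast; linarith
  refine (ENNReal.ofReal_le_ofReal h2).trans ?_
  rw [ENNReal.ofReal_natCast]
  push_cast
  gcongr

/-- With `m` the first index such that `x ≤ β m`, the terms are at most `((m + 1) / (k + 1)) ^ (2 /
p)` for `k ≥ m`. As `2 / p > 1`, their sum is of order `m + 1`. -/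
theorem exists_tsum_sq_le_countBelow (h : IsNorming p β) (hp : 0 < p) (hp2 : p < 2) :
    ∃ C : ℝ≥0, ∀ x : ℝ, 0 ≤ x →
      ∑' k, (if x ≤ β k then ENNReal.ofReal ((x / β k) ^ 2) else 0) ≤
        C * (countBelow β x + 1) := by
  -- The maximum with `1` covers the quotient `j = 0`, where the ratio is bounded by `1` only.
  let g : ℕ → ℝ := fun j => ((max 1 (j : ℝ))⁻¹) ^ (2 / p)
  have hg0 : ∀ j, 0 ≤ g j := fun j => by positivity
  have hg : Summable g := by
    refine (summable_nat_add_iff 1).1 ?_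
    have h1 : Summable fun n : ℕ => (((n + 1 : ℕ) : ℝ) ^ (2 / p))⁻¹ :=
      (summable_nat_add_iff (f := fun n : ℕ => ((n : ℝ) ^ (2 / p))⁻¹) 1).2
        (Real.summable_nat_rpow_inv.2 ((one_lt_div hp).2 hp2))
    refine h1.congr fun n => ?_
    simp only [g]
    rw [max_eq_right (by push_cast; linarith [n.cast_nonneg (α := ℝ)]),
      Real.inv_rpow (by positivity)]
  have hgt : ∑' j, ENNReal.ofReal (g j) ≠ ∞ := by
    rw [← ENNReal.ofReal_tsum_of_nonneg hg0 hg]; exact ENNReal.ofReal_ne_top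
  refine ⟨(∑' j, ENNReal.ofReal (g j)).toNNReal, fun x hx0 => ?_⟩
  rw [ENNReal.coe_toNNReal hgt]
  by_cases hex : ∃ n, x ≤ β n
  swap
  · push Not at hex
    simp [fun k => not_le.2 (hex k)]
  obtain ⟨n, hn⟩ := hex
  obtain ⟨m, hm1, hm2, hm3⟩ := exists_first_le hn
  have hterm : ∀ k, (if x ≤ β k then ENNReal.ofReal ((x / β k) ^ 2) else 0) ≤
      ENNReal.ofReal (g (k / (m + 1))) := by
    intro k
    split_ifs with hk
    swap
    · exact zero_le
    refine ENNReal.ofReal_le_ofReal ?_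
    have hβk := h.pos k
    have hmk := hm1 k hk
    have h1 : x / β k ≤ (((m : ℝ) + 1) / ((k : ℝ) + 1)) ^ (1 / p) := by
      refine le_trans ?_ (h.div_le_rpow hmk)
      gcongr
    have h2 : ((m : ℝ) + 1) / ((k : ℝ) + 1) ≤ (max 1 ((k / (m + 1) : ℕ) : ℝ))⁻¹ := by
      rw [← one_div, div_le_div_iff₀ (by positivity) (by positivity), one_mul,
        mul_max_of_nonneg _ _ (by positivity)]
      refine max_le ?_ ?_
      · have : (m : ℝ) ≤ k := by exact_mod_cast hmk
        linarith
      · have := Nat.mul_div_le k (m + 1)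
        have : ((m : ℝ) + 1) * ((k / (m + 1) : ℕ) : ℝ) ≤ k := by exact_mod_cast this
        linarith
    calc (x / β k) ^ 2 ≤ ((((m : ℝ) + 1) / ((k : ℝ) + 1)) ^ (1 / p)) ^ 2 := by gcongr
      _ = (((m : ℝ) + 1) / ((k : ℝ) + 1)) ^ (2 / p) := by
          rw [← Real.rpow_natCast, ← Real.rpow_mul (by positivity)]
          push_cast; congr 1; ring
      _ ≤ _ := Real.rpow_le_rpow (by positivity) h2 (by positivity)
  calc _ ≤ ∑' k : ℕ, ENNReal.ofReal (g (k / (m + 1))) := ENNReal.tsum_le_tsum hterm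
    _ = (∑' j, ENNReal.ofReal (g j)) * (m + 1) :=
        ENNReal.tsum_comp_div (fun j => ENNReal.ofReal (g j)) m
    _ ≤ _ := by gcongr

end IsNorming

end Norming

/-! ### From dyadic blocks to normed sums. -/

section BlockSums

theorem tendsto_zero_of_le_mul_add {e δ : ℕ → ℝ} {ρ : ℝ} (he : ∀ k, 0 ≤ e k) (hρ0 : 0 ≤ ρ)
    (hρ1 : ρ < 1) (hrec : ∀ k, e (k + 1) ≤ ρ * e k + δ k) (hδ : Tendsto δ atTop (𝓝 0)) :
    Tendsto e atTop (𝓝 0) := by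
  rw [Metric.tendsto_atTop]
  intro ε hε
  -- With this threshold for `δ`, the value `ε / 2` is the fixed point of the majorizing recursion.
  have h1 : 0 < (1 - ρ) * (ε / 2) := by
    have : 0 < 1 - ρ := by linarith
    positivity
  obtain ⟨K, hK⟩ := eventually_atTop.1 (hδ.eventually (gt_mem_nhds h1))
  have h2 : ∀ j, e (K + j) ≤ ρ ^ j * e K + ε / 2 := by
    intro j
    induction j with
    | zero => simp; positivity
    | succ j ih =>
      have h3 := hrec (K + j)
      have h4 := hK (K + j) (by omega)
      have h5 := mul_le_mul_of_nonneg_left ih hρ0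
      rw [← add_assoc, pow_succ]
      nlinarith
  have h3 : Tendsto (fun j => ρ ^ j * e K) atTop (𝓝 0) := by
    simpa using (tendsto_pow_atTop_nhds_zero_of_lt_one hρ0 hρ1).mul_const (e K)
  obtain ⟨J, hJ⟩ := eventually_atTop.1 (h3.eventually (gt_mem_nhds (half_pos hε)))
  refine ⟨K + J, fun n hn => ?_⟩
  obtain ⟨j, rfl⟩ : ∃ j, n = K + j := ⟨n - K, by omega⟩
  have h4 := h2 j
  have h5 := hJ j (by omega)
  rw [Real.dist_0_eq_abs, abs_of_nonneg (he _)]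
  linarith

variable {B : Type*} [NormedAddCommGroup B] [NormedSpace ℝ B]

/-- Abel's inequality with nondecreasing nonnegative weights. -/
theorem norm_sum_smul_le_maxPartialSum {a : ℕ → ℝ} (ha0 : ∀ i, 0 ≤ a i) (ha : Monotone a)
    (u : ℕ → B) {k N : ℕ} (hk : k ≤ N) :
    ‖∑ i ∈ Finset.range (k + 1), a i • u i‖ ≤ 2 * a k * maxPartialSum u N := by
  have hM := maxPartialSum_nonneg u N
  -- Summation by parts as an induction: each step adds one weight increment times an earlier
  -- partial sum, and the increments telescope.
  have h1 : ∀ j ≤ N, ‖∑ i ∈ Finset.range (j + 1), a i • u i -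
      a j • ∑ i ∈ Finset.range (j + 1), u i‖ ≤ (a j - a 0) * maxPartialSum u N := by
    intro j
    induction j with
    | zero => simp
    | succ j ih =>
      intro hj
      have h2 := ih (by omega)
      have h3 := norm_sum_le_maxPartialSum u (show j ≤ N by omega)
      have h4 : 0 ≤ a (j + 1) - a j := sub_nonneg.2 (ha (Nat.le_succ j))
      have e : ∑ i ∈ Finset.range (j + 1 + 1), a i • u i -
          a (j + 1) • ∑ i ∈ Finset.range (j + 1 + 1), u i =
          (∑ i ∈ Finset.range (j + 1), a i • u i - a j • ∑ i ∈ Finset.range (j + 1), u i) -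
          (a (j + 1) - a j) • ∑ i ∈ Finset.range (j + 1), u i := by
        rw [Finset.sum_range_succ _ (j + 1), Finset.sum_range_succ _ (j + 1), smul_add, sub_smul]
        abel
      rw [e]
      refine (norm_sub_le _ _).trans ?_
      rw [norm_smul, Real.norm_eq_abs, abs_of_nonneg h4]
      nlinarith [mul_le_mul_of_nonneg_left h3 h4]
  have h2 := h1 k hk
  have h3 := norm_sum_le_maxPartialSum u hk
  have h4 := norm_sub_norm_le (∑ i ∈ Finset.range (k + 1), a i • u i)
    (a k • ∑ i ∈ Finset.range (k + 1), u i)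
  rw [norm_smul, Real.norm_eq_abs, abs_of_nonneg (ha0 k)] at h4
  nlinarith [mul_le_mul_of_nonneg_left h3 (ha0 k), mul_nonneg (ha0 0) hM]

/-- This replaces Kronecker's lemma, without requiring `∑ u i` to converge. Block `k` starts at `2 ^
k - 1` and has `2 ^ k` terms. Passing to the next block shrinks the normed past by a factor `(1 / 2)
^ (1 / p) < 1`, while the new terms contribute at most `2 * M k`. -/
theorem IsNorming.tendsto_norm_sum_smul_div {p : ℝ} {β : ℕ → ℝ} (h : IsNorming p β) (hp : 0 < p)
    {u : ℕ → B}
    (hM : Tendsto (fun k => maxPartialSum (fun i => u (2 ^ k - 1 + i)) (2 ^ k - 1)) atTop (𝓝 0)) :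
    Tendsto (fun n => ‖∑ i ∈ Finset.range (n + 1), β i • u i‖ / β n) atTop (𝓝 0) := by
  set M : ℕ → ℝ := fun k => maxPartialSum (fun i => u (2 ^ k - 1 + i)) (2 ^ k - 1) with hMdef
  have hmono := h.monotone hp
  let D : ℕ → B := fun n => ∑ i ∈ Finset.range n, β i • u i
  have hD : ∀ k j, j ≤ 2 ^ k - 1 →
      ‖D (2 ^ k - 1 + j + 1)‖ ≤ ‖D (2 ^ k - 1)‖ + 2 * β (2 ^ k - 1 + j) * M k := by
    intro k j hj
    have e : D (2 ^ k - 1 + j + 1) = D (2 ^ k - 1) +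
        ∑ i ∈ Finset.range (j + 1), β (2 ^ k - 1 + i) • u (2 ^ k - 1 + i) := by
      simp only [D, add_assoc, Finset.sum_range_add]
    rw [e]
    refine (norm_add_le _ _).trans (add_le_add le_rfl ?_)
    exact norm_sum_smul_le_maxPartialSum (a := fun i => β (2 ^ k - 1 + i))
      (fun i => (h.pos _).le) (fun i j hij => hmono (by omega)) _ hj
  let e : ℕ → ℝ := fun k => ‖D (2 ^ k - 1)‖ / β (2 ^ k - 1)
  have he0 : ∀ k, 0 ≤ e k := fun k => div_nonneg (norm_nonneg _) (h.pos _).le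
  have hM0 : ∀ k, 0 ≤ M k := fun k => maxPartialSum_nonneg _ _
  have he : Tendsto e atTop (𝓝 0) := by
    refine tendsto_zero_of_le_mul_add (ρ := (1 / 2 : ℝ) ^ (1 / p)) (δ := fun k => 2 * M k) he0
      (by positivity) (Real.rpow_lt_one (by norm_num) (by norm_num) (by positivity)) ?_
      (by simpa using hM.const_mul 2)
    intro k
    have hpow : 1 ≤ 2 ^ k := Nat.one_le_two_pow
    have hidx : 2 ^ k - 1 + (2 ^ k - 1) + 1 = 2 ^ (k + 1) - 1 := by rw [pow_succ]; omega
    have h1 := hD k (2 ^ k - 1) le_rfl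
    rw [hidx] at h1
    have hle : 2 ^ k - 1 ≤ 2 ^ (k + 1) - 1 := by omega
    have h2 : β (2 ^ k - 1 + (2 ^ k - 1)) / β (2 ^ (k + 1) - 1) ≤ 1 :=
      h.div_le_one hp (by omega)
    have h3 := h.div_le_rpow hle
    have e3 : (((2 ^ k - 1 : ℕ) : ℝ) + 1) / (((2 ^ (k + 1) - 1 : ℕ) : ℝ) + 1) = 1 / 2 := by
      rw [Nat.cast_sub hpow, Nat.cast_sub Nat.one_le_two_pow]
      push_cast
      rw [sub_add_cancel, sub_add_cancel, pow_succ]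
      field_simp
    rw [e3] at h3
    have hb1 := h.pos (2 ^ k - 1)
    have hb2 := h.pos (2 ^ (k + 1) - 1)
    calc e (k + 1) ≤ (‖D (2 ^ k - 1)‖ + 2 * β (2 ^ k - 1 + (2 ^ k - 1)) * M k) /
          β (2 ^ (k + 1) - 1) := by simp only [e]; gcongr
      _ = β (2 ^ k - 1) / β (2 ^ (k + 1) - 1) * e k +
          β (2 ^ k - 1 + (2 ^ k - 1)) / β (2 ^ (k + 1) - 1) * (2 * M k) := by
          simp only [e]; field_simp
      _ ≤ (1 / 2 : ℝ) ^ (1 / p) * e k + 1 * (2 * M k) := by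
          have := he0 k
          have := hM0 k
          gcongr
      _ = _ := by ring
  -- The index `n` lies in the block numbered `Nat.log 2 (n + 1)`.
  have hlog : Tendsto (fun n : ℕ => Nat.log 2 (n + 1)) atTop atTop := by
    refine Filter.tendsto_atTop.2 fun k => ?_
    filter_upwards [eventually_ge_atTop (2 ^ k)] with n hn
    exact (Nat.le_log_iff_pow_le (by norm_num) (by omega)).2 (by omega)
  have hlim : Tendsto (fun n : ℕ => e (Nat.log 2 (n + 1)) + 2 * M (Nat.log 2 (n + 1))) atTop
      (𝓝 0) := by
    simpa using (he.comp hlog).add ((hM.comp hlog).const_mul 2)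
  refine squeeze_zero (fun n => div_nonneg (norm_nonneg _) (h.pos _).le) (fun n => ?_) hlim
  have hk1 := Nat.pow_log_le_self 2 (show n + 1 ≠ 0 by omega)
  have hk2 := Nat.lt_pow_succ_log_self (b := 2) (by norm_num) (n + 1)
  set k := Nat.log 2 (n + 1)
  have hpow : 1 ≤ 2 ^ k := Nat.one_le_two_pow
  rw [pow_succ] at hk2
  obtain ⟨j, hj⟩ : ∃ j, n = 2 ^ k - 1 + j := ⟨n - (2 ^ k - 1), by omega⟩
  have h1 := hD k j (by omega)
  rw [← hj] at h1
  have hb1 := h.pos (2 ^ k - 1)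
  have hb2 := h.pos n
  have h2 : β (2 ^ k - 1) / β n ≤ 1 := h.div_le_one hp (by omega)
  calc ‖D (n + 1)‖ / β n ≤ (‖D (2 ^ k - 1)‖ + 2 * β n * M k) / β n := by gcongr
    _ = β (2 ^ k - 1) / β n * e k + 2 * M k := by simp only [e]; field_simp
    _ ≤ 1 * e k + 2 * M k := by
        have := he0 k
        gcongr
    _ = _ := by ring

end BlockSums

/-! ### Almost sure convergence of the block maxima. -/

section BlockConvergence

theorem summable_sum_dyadic_block {a : ℕ → ℝ} (ha0 : ∀ i, 0 ≤ a i) (ha : Summable a) :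
    Summable fun k : ℕ => ∑ i ∈ Finset.range (2 ^ k - 1 + 1), a (2 ^ k - 1 + i) := by
  refine summable_of_sum_range_le (c := ∑' i, a i)
    (fun k => Finset.sum_nonneg fun i _ => ha0 _) fun K => ?_
  have h1 : ∑ k ∈ Finset.range K, ∑ i ∈ Finset.range (2 ^ k - 1 + 1), a (2 ^ k - 1 + i) =
      ∑ i ∈ Finset.range (2 ^ K - 1), a i := by
    induction K with
    | zero => simp
    | succ K ih =>
      have hpow : 1 ≤ 2 ^ K := Nat.one_le_two_pow
      have e : 2 ^ (K + 1) - 1 = (2 ^ K - 1) + (2 ^ K - 1 + 1) := by rw [pow_succ]; omega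
      rw [Finset.sum_range_succ, ih, e]
      exact (Finset.sum_range_add a _ _).symm
  rw [h1]
  exact ha.sum_le_tsum _ fun i _ => ha0 i

variable {Ω : Type*} [MeasurableSpace Ω] {P : Measure Ω} [IsProbabilityMeasure P]

/-- Chebyshev and Borel–Cantelli give `M k - E (M k) → 0` almost surely. Convergence in probability
is then needed only to send the numbers `E (M k)` to zero. -/
theorem ae_tendsto_zero_of_summable_variance {M : ℕ → Ω → ℝ} (hM0 : ∀ k ω, 0 ≤ M k ω)
    (hL2 : ∀ k, MemLp (M k) 2 P) (hvar : Summable fun k => Var[M k; P])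
    (hprob : ∀ ε : ℝ≥0, 0 < ε → Tendsto (fun k => P {ω | (ε : ℝ) ≤ M k ω}) atTop (𝓝 0)) :
    ∀ᵐ ω ∂P, Tendsto (fun k => M k ω) atTop (𝓝 0) := by
  have hsum : ∀ ε : ℝ, 0 < ε → ∑' k, P {ω | ε ≤ |M k ω - P[M k]|} ≠ ∞ := by
    intro ε hε
    have h1 : ∀ k, P {ω | ε ≤ |M k ω - P[M k]|} ≤ ENNReal.ofReal (Var[M k; P] / ε ^ 2) :=
      fun k => meas_ge_le_variance_div_sq (hL2 k) hε
    refine ne_top_of_le_ne_top ?_ (ENNReal.tsum_le_tsum h1)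
    rw [← ENNReal.ofReal_tsum_of_nonneg
      (fun k => div_nonneg (variance_nonneg _ _) (by positivity)) (hvar.div_const _)]
    exact ENNReal.ofReal_ne_top
  have hmean : Tendsto (fun k => P[M k]) atTop (𝓝 0) := by
    rw [Metric.tendsto_atTop]
    intro ε hε
    have h1 := ENNReal.tendsto_atTop_zero_of_tsum_ne_top (hsum (ε / 2) (half_pos hε))
    have h2 := hprob ⟨ε / 2, (half_pos hε).le⟩ (half_pos hε)
    have h3 := h1.add h2
    rw [add_zero] at h3
    obtain ⟨K, hK⟩ := eventually_atTop.1 (h3.eventually (gt_mem_nhds one_pos))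
    refine ⟨K, fun k hk => ?_⟩
    have h4 := (measure_union_le (μ := P) {ω | ε / 2 ≤ |M k ω - P[M k]|}
      {ω | ε / 2 ≤ M k ω}).trans_lt (hK k hk)
    -- The two exceptional events have total probability below `1`. At any point outside them, `M k`
    -- is small and close to its mean, so the mean is small.
    obtain ⟨ω, hω⟩ : ∃ ω, ω ∉ {ω | ε / 2 ≤ |M k ω - P[M k]|} ∪ {ω | ε / 2 ≤ M k ω} := by
      by_contra! hcon
      rw [Set.eq_univ_of_forall hcon, measure_univ] at h4
      exact lt_irrefl _ h4
    simp only [Set.mem_union, Set.mem_ofPred_eq, not_or, not_le] at hω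
    have h5 : 0 ≤ P[M k] := integral_nonneg (hM0 k)
    rw [Real.dist_0_eq_abs, abs_of_nonneg h5]
    have := (abs_lt.1 hω.1).1
    linarith
  have hae : ∀ᵐ ω ∂P, ∀ j : ℕ, ∀ᶠ k in atTop,
      ω ∉ {ω | (1 / ((j : ℝ) + 1)) ≤ |M k ω - P[M k]|} :=
    ae_all_iff.2 fun j => ae_eventually_notMem (hsum _ (by positivity))
  filter_upwards [hae] with ω hω
  have h1 : Tendsto (fun k => M k ω - P[M k]) atTop (𝓝 0) := by
    rw [Metric.tendsto_nhds]
    intro ε hε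
    obtain ⟨j, hj⟩ := exists_nat_one_div_lt hε
    filter_upwards [hω j] with k hk
    simp only [not_le] at hk
    rw [Real.dist_0_eq_abs]
    exact hk.trans hj
  simpa using h1.add hmean

variable {B : Type*} [NormedAddCommGroup B] [NormedSpace ℝ B] [CompleteSpace B]
  [TopologicalSpace.SeparableSpace B] [MeasurableSpace B] [BorelSpace B]

theorem ae_tendsto_maxPartialSum_dyadic {Z : ℕ → Ω → B} (hZ : ∀ i, Measurable (Z i))
    (hind : iIndepFun Z P) (hL2 : ∀ i, MemLp (Z i) 2 P)
    (hsum : Summable fun i => ∫ ω, ‖Z i ω‖ ^ 2 ∂P)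
    (hmean : Tendsto (fun k : ℕ => ∫ ω, ‖∑ i ∈ Finset.range (2 ^ k - 1 + 1),
      (Z (2 ^ k - 1 + i) ω - ∫ ω', Z (2 ^ k - 1 + i) ω' ∂P)‖ ∂P) atTop (𝓝 0)) :
    ∀ᵐ ω ∂P, Tendsto (fun k : ℕ => maxPartialSum
      (fun i => Z (2 ^ k - 1 + i) ω - ∫ ω', Z (2 ^ k - 1 + i) ω' ∂P) (2 ^ k - 1)) atTop
      (𝓝 0) := by
  have hinj : ∀ s : ℕ, Function.Injective fun i : ℕ => s + i := fun s => add_right_injective s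
  have hv := fun k : ℕ => variance_maxPartialSum_le (Z := fun i => Z (2 ^ k - 1 + i))
    (fun i => hZ _) (hind.precomp (hinj _)) (fun i => hL2 _)
    (fun i => ∫ ω', Z (2 ^ k - 1 + i) ω' ∂P) (2 ^ k - 1)
  have hint : ∀ i, Integrable (Z i) P := fun i => (hL2 i).integrable (by norm_num)
  refine ae_tendsto_zero_of_summable_variance (fun k ω => maxPartialSum_nonneg _ _)
    (fun k => (hv k).2) ?_ ?_
  · exact (summable_sum_dyadic_block (fun i => integral_nonneg fun ω => by positivity)
      hsum).of_nonneg_of_le (fun k => variance_nonneg _ _) fun k => (hv k).1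
  · intro ε hε
    have hd := fun k : ℕ => mul_measure_le_maxPartialSum (P := P)
      (Z := fun i ω => Z (2 ^ k - 1 + i) ω - ∫ ω', Z (2 ^ k - 1 + i) ω' ∂P)
      (fun i => (hZ _).sub_const _)
      ((hind.precomp (hinj (2 ^ k - 1))).comp
        (fun i x => x - ∫ ω', Z (2 ^ k - 1 + i) ω' ∂P) fun i => measurable_id.sub_const _)
      (fun i => (hint _).sub (integrable_const _))
      (fun i => by rw [integral_sub (hint _) (integrable_const _)]; simp) ε (2 ^ k - 1)
    have hlim := ENNReal.tendsto_ofReal hmean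
    rw [ENNReal.ofReal_zero] at hlim
    have hε' : (ε : ℝ≥0∞) ≠ 0 := by exact_mod_cast hε.ne'
    have h1 := tendsto_of_tendsto_of_tendsto_of_le_of_le tendsto_const_nhds hlim
      (fun k => zero_le) hd
    have h2 := ENNReal.Tendsto.const_mul (a := (ε : ℝ≥0∞)⁻¹) h1
      (Or.inr (ENNReal.inv_ne_top.2 hε'))
    rw [mul_zero] at h2
    refine h2.congr fun k => ?_
    rw [← mul_assoc, ENNReal.inv_mul_cancel hε' ENNReal.coe_ne_top, one_mul]

end BlockConvergence

/-! ### Mean norms of truncated block sums. -/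

section TruncatedBlocks

theorem exists_linear_growth_simpleFunc {B : Type*} [NormedAddCommGroup B] [MeasurableSpace B]
    (φ : SimpleFunc B B) :
    ∃ K, ∀ x, ‖φ x‖ ≤ K * (1 + ‖x‖) := by
  obtain ⟨K, hK⟩ := φ.exists_forall_norm_le
  refine ⟨K, fun x => (hK x).trans ?_⟩
  have h1 : 0 ≤ K := (norm_nonneg _).trans (hK x)
  nlinarith [mul_nonneg h1 (norm_nonneg x)]

variable {B : Type*} [NormedAddCommGroup B] [NormedSpace ℝ B]

/-- The function `g` truncated to the ball of radius `β i` and divided by `β i`. -/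
noncomputable def truncScale (β : ℕ → ℝ) (g : B → B) (i : ℕ) : B → B :=
  {x | ‖x‖ ≤ β i}.indicator fun x => (β i)⁻¹ • g x

theorem truncScale_of_le {β : ℕ → ℝ} (g : B → B) {i : ℕ} {x : B} (h : ‖x‖ ≤ β i) :
    truncScale β g i x = (β i)⁻¹ • g x :=
  Set.indicator_of_mem (s := {x | ‖x‖ ≤ β i}) h _

theorem truncScale_of_lt {β : ℕ → ℝ} (g : B → B) {i : ℕ} {x : B} (h : β i < ‖x‖) :
    truncScale β g i x = 0 :=
  Set.indicator_of_notMem (s := {x | ‖x‖ ≤ β i}) (not_le.2 h) _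

theorem truncScale_add (β : ℕ → ℝ) (g₁ g₂ : B → B) (i : ℕ) (x : B) :
    truncScale β (g₁ + g₂) i x = truncScale β g₁ i x + truncScale β g₂ i x := by
  rcases le_or_gt ‖x‖ (β i) with h | h
  · simp [truncScale_of_le _ h]
  · simp [truncScale_of_lt _ h]

theorem norm_truncScale_le (β : ℕ → ℝ) {g : B → B} {K : ℝ} (hg : ∀ x, ‖g x‖ ≤ K * (1 + ‖x‖))
    (i : ℕ) (x : B) : ‖truncScale β g i x‖ ≤ |(β i)⁻¹| * (|K| * (1 + |β i|)) := by
  rcases le_or_gt ‖x‖ (β i) with h | h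
  · rw [truncScale_of_le _ h, norm_smul, Real.norm_eq_abs]
    gcongr
    refine (hg x).trans ?_
    gcongr
    · exact le_abs_self K
    · exact h.trans (le_abs_self _)
  · rw [truncScale_of_lt _ h, norm_zero]; positivity

variable [MeasurableSpace B] [BorelSpace B]

theorem measurable_truncScale (β : ℕ → ℝ) {g : B → B} (hg : Measurable g) (i : ℕ) :
    Measurable (truncScale β g i) :=
  (hg.const_smul _).indicator (measurableSet_le measurable_norm measurable_const)

variable {Ω : Type*} [MeasurableSpace Ω] (P : Measure Ω)

/-- The centred variable `truncScale β g i (Xs i) - E (truncScale β g i (Xs i))`. -/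
noncomputable def centeredTrunc (β : ℕ → ℝ) (Xs : ℕ → Ω → B) (g : B → B) (i : ℕ) (ω : Ω) : B :=
  truncScale β g i (Xs i ω) - ∫ ω', truncScale β g i (Xs i ω') ∂P

/-- The mean norm of the sum of the centred variables over the `k`-th dyadic block. -/
noncomputable def blockDeviation (β : ℕ → ℝ) (Xs : ℕ → Ω → B) (g : B → B) (k : ℕ) : ℝ≥0∞ :=
  ∫⁻ ω, ‖∑ i ∈ Finset.range (2 ^ k - 1 + 1), centeredTrunc P β Xs g (2 ^ k - 1 + i) ω‖ₑ ∂P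

variable {P} {β : ℕ → ℝ} {X : Ω → B} {Xs : ℕ → Ω → B}

theorem measurable_centeredTrunc (hXs : ∀ n, Measurable (Xs n)) {g : B → B} (hg : Measurable g)
    (i : ℕ) : Measurable (centeredTrunc P β Xs g i) :=
  ((measurable_truncScale β hg i).comp (hXs i)).sub_const _

theorem iIndepFun_centeredTrunc (hind : iIndepFun Xs P) {g : B → B} (hg : Measurable g) :
    iIndepFun (centeredTrunc P β Xs g) P :=
  hind.comp (fun i x => truncScale β g i x - ∫ ω', truncScale β g i (Xs i ω') ∂P)
    fun i => (measurable_truncScale β hg i).sub_const _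

/-- All summands are scalar multiples of `c`, so the `L²` norm suffices: the variance of a block sum
is at most a block of the convergent series `∑ (β i)⁻¹ ^ 2`. -/
theorem tendsto_blockDeviation_indicator [IsProbabilityMeasure P] [CompleteSpace B]
    (hXs : ∀ n, Measurable (Xs n)) (hind : iIndepFun Xs P)
    (hβ : Summable fun i => ((β i)⁻¹) ^ 2) {s : Set B} (hs : MeasurableSet s) (c : B) :
    Tendsto (blockDeviation P β Xs (s.indicator fun _ => c)) atTop (𝓝 0) := by
  let φ : ℕ → B → ℝ := fun i => ({x | ‖x‖ ≤ β i} ∩ s).indicator fun _ => (β i)⁻¹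
  have hφm : ∀ i, Measurable (φ i) := fun i =>
    measurable_const.indicator ((measurableSet_le measurable_norm measurable_const).inter hs)
  have hφb : ∀ i x, |φ i x| ≤ |(β i)⁻¹| := by
    intro i x
    by_cases hx : x ∈ {x | ‖x‖ ≤ β i} ∩ s
    · simp only [φ]; rw [Set.indicator_of_mem hx]
    · simp only [φ]; rw [Set.indicator_of_notMem hx]; simp
  have hφt : ∀ i x, truncScale β (s.indicator fun _ => c) i x = φ i x • c := by
    intro i x
    simp only [truncScale, φ, Set.indicator_apply, Set.mem_ofPred_eq]
    by_cases h1 : ‖x‖ ≤ β i <;> by_cases h2 : x ∈ s <;> simp [h1, h2]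
  let ξ : ℕ → Ω → ℝ := fun i ω => φ i (Xs i ω)
  have hξm : ∀ i, Measurable (ξ i) := fun i => (hφm i).comp (hXs i)
  have hξL : ∀ i, MemLp (ξ i) 2 P := fun i =>
    MemLp.of_bound (hξm i).aestronglyMeasurable _ (ae_of_all _ fun ω => hφb i _)
  have hξi : ∀ i, Integrable (ξ i) P := fun i => (hξL i).integrable (by norm_num)
  have hξind : iIndepFun ξ P := hind.comp φ hφm
  have hcent : ∀ i ω, centeredTrunc P β Xs (s.indicator fun _ => c) i ω =
      (ξ i ω - ∫ ω', ξ i ω' ∂P) • c := by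
    intro i ω
    simp only [centeredTrunc, hφt, sub_smul, ξ]
    rw [integral_smul_const]
  let V : ℕ → ℝ := fun k => ∑ i ∈ Finset.range (2 ^ k - 1 + 1), ((β (2 ^ k - 1 + i))⁻¹) ^ 2
  have hV : Tendsto V atTop (𝓝 0) :=
    (summable_sum_dyadic_block (fun i => sq_nonneg _) hβ).tendsto_atTop_zero
  have hbound : ∀ k, blockDeviation P β Xs (s.indicator fun _ => c) k ≤
      ENNReal.ofReal (V k) ^ (1 / 2 : ℝ) * ‖c‖ₑ := by
    intro k
    let S : Ω → ℝ := ∑ i ∈ Finset.range (2 ^ k - 1 + 1), ξ (2 ^ k - 1 + i)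
    have hSL : MemLp S 2 P := memLp_finsetSum' _ fun i _ => hξL _
    have hSm : Measurable S := by
      have : S = fun ω => ∑ i ∈ Finset.range (2 ^ k - 1 + 1), ξ (2 ^ k - 1 + i) ω := by
        funext ω; simp [S]
      rw [this]
      exact Finset.measurable_sum _ fun i _ => hξm _
    have hS : ∀ ω, ∑ i ∈ Finset.range (2 ^ k - 1 + 1),
        centeredTrunc P β Xs (s.indicator fun _ => c) (2 ^ k - 1 + i) ω =
        (S ω - ∫ ω', S ω' ∂P) • c := by
      intro ω
      simp only [hcent]
      rw [← Finset.sum_smul, Finset.sum_sub_distrib]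
      simp only [S, Finset.sum_apply]
      rw [integral_finsetSum _ fun i _ => hξi _]
    have hvar : Var[S; P] ≤ V k := by
      simp only [S]
      rw [IndepFun.variance_sum (fun i _ => hξL _) fun i _ j _ hij =>
        hξind.indepFun (by simpa using hij)]
      refine Finset.sum_le_sum fun i _ => ?_
      refine (variance_le_expectation_sq (hξL _).aestronglyMeasurable).trans ?_
      have : ∫ ω, (ξ (2 ^ k - 1 + i) ^ 2) ω ∂P ≤ ∫ ω, ((β (2 ^ k - 1 + i))⁻¹) ^ 2 ∂P :=
        integral_mono (hξL _).integrable_sq (integrable_const _) fun ω => sq_le_sq.2 (hφb _ _)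
      simpa using this
    unfold blockDeviation
    simp only [hS, enorm_smul]
    rw [lintegral_mul_const _ (by fun_prop)]
    gcongr
    refine (lintegral_le_rpow_lintegral_rpow (p := 2) (by fun_prop) (by norm_num)).trans ?_
    gcongr
    simp only [ENNReal.rpow_ofNat]
    refine le_trans (le_of_eq (ofReal_variance hSL).symm) (ENNReal.ofReal_le_ofReal hvar)
  have hlim : Tendsto (fun k => ENNReal.ofReal (V k) ^ (1 / 2 : ℝ) * ‖c‖ₑ) atTop (𝓝 0) := by
    have h1 := ENNReal.tendsto_ofReal hV
    have h2 := (ENNReal.continuous_rpow_const (y := (1 / 2 : ℝ))).tendsto (ENNReal.ofReal 0)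
    have h3 := ENNReal.Tendsto.mul_const (h2.comp h1) (b := ‖c‖ₑ) (Or.inr enorm_ne_top)
    simpa using h3
  exact tendsto_of_tendsto_of_tendsto_of_le_of_le tendsto_const_nhds hlim (fun k => zero_le) hbound

variable [IsProbabilityMeasure P] [TopologicalSpace.SeparableSpace B]

theorem integrable_truncScale (hXs : ∀ n, Measurable (Xs n)) {g : B → B} (hg : Measurable g)
    (hgK : ∃ K, ∀ x, ‖g x‖ ≤ K * (1 + ‖x‖)) (i : ℕ) :
    Integrable (fun ω => truncScale β g i (Xs i ω)) P := by
  obtain ⟨K, hK⟩ := hgK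
  exact Integrable.of_bound
    ((measurable_truncScale β hg i).comp (hXs i)).aestronglyMeasurable _
    (ae_of_all _ fun ω => norm_truncScale_le β hK i _)

theorem integrable_centeredTrunc (hXs : ∀ n, Measurable (Xs n)) {g : B → B} (hg : Measurable g)
    (hgK : ∃ K, ∀ x, ‖g x‖ ≤ K * (1 + ‖x‖)) (i : ℕ) :
    Integrable (centeredTrunc P β Xs g i) P :=
  (integrable_truncScale hXs hg hgK i).sub (integrable_const _)

theorem integral_centeredTrunc [CompleteSpace B] (hXs : ∀ n, Measurable (Xs n)) {g : B → B}
    (hg : Measurable g) (hgK : ∃ K, ∀ x, ‖g x‖ ≤ K * (1 + ‖x‖)) (i : ℕ) :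
    ∫ ω, centeredTrunc P β Xs g i ω ∂P = 0 := by
  simp only [centeredTrunc]
  rw [integral_sub (integrable_truncScale hXs hg hgK i) (integrable_const _)]; simp

theorem blockDeviation_add_le (hXs : ∀ n, Measurable (Xs n)) {g₁ g₂ : B → B}
    (hg₁ : Measurable g₁) (hg₂ : Measurable g₂) (hK₁ : ∃ K, ∀ x, ‖g₁ x‖ ≤ K * (1 + ‖x‖))
    (hK₂ : ∃ K, ∀ x, ‖g₂ x‖ ≤ K * (1 + ‖x‖)) (k : ℕ) :
    blockDeviation P β Xs (g₁ + g₂) k ≤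
      blockDeviation P β Xs g₁ k + blockDeviation P β Xs g₂ k := by
  unfold blockDeviation
  rw [← lintegral_add_left (Measurable.enorm (Finset.measurable_fun_sum _ fun i _ =>
    measurable_centeredTrunc hXs hg₁ _))]
  refine lintegral_mono fun ω => ?_
  have e : ∀ i, centeredTrunc P β Xs (g₁ + g₂) i ω =
      centeredTrunc P β Xs g₁ i ω + centeredTrunc P β Xs g₂ i ω := by
    intro i
    simp only [centeredTrunc, truncScale_add]
    rw [integral_add (integrable_truncScale hXs hg₁ hK₁ i) (integrable_truncScale hXs hg₂ hK₂ i)]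
    abel
  simp only [e, Finset.sum_add_distrib]
  exact enorm_add_le _ _

/-- Convexity costs `2 ^ (p - 1)`; Jensen bounds the term from the mean by the same moment, which
doubles it. -/
theorem lintegral_enorm_sub_integral_rpow_le {Z : Ω → B} (hZ : Measurable Z) {p : ℝ}
    (hp : 1 ≤ p) :
    ∫⁻ ω, ‖Z ω - ∫ ω', Z ω' ∂P‖ₑ ^ p ∂P ≤ 2 ^ p * ∫⁻ ω, ‖Z ω‖ₑ ^ p ∂P := by
  have hp0 : 0 < p := by linarith
  have h1 : ‖∫ ω', Z ω' ∂P‖ₑ ^ p ≤ ∫⁻ ω, ‖Z ω‖ₑ ^ p ∂P := by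
    calc ‖∫ ω', Z ω' ∂P‖ₑ ^ p ≤ ((∫⁻ ω, ‖Z ω‖ₑ ^ p ∂P) ^ (1 / p)) ^ p := by
          gcongr
          exact (enorm_integral_le_lintegral_enorm _).trans
            (lintegral_le_rpow_lintegral_rpow hZ.enorm hp)
      _ = _ := by
          rw [← ENNReal.rpow_mul, one_div, inv_mul_cancel₀ hp0.ne', ENNReal.rpow_one]
  calc ∫⁻ ω, ‖Z ω - ∫ ω', Z ω' ∂P‖ₑ ^ p ∂P
      ≤ ∫⁻ ω, 2 ^ (p - 1) * (‖Z ω‖ₑ ^ p + ‖∫ ω', Z ω' ∂P‖ₑ ^ p) ∂P := by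
        refine lintegral_mono fun ω => ?_
        refine le_trans ?_ (ENNReal.rpow_add_le_mul_rpow_add_rpow _ _ hp)
        gcongr
        exact enorm_sub_le
    _ = 2 ^ (p - 1) * (∫⁻ ω, ‖Z ω‖ₑ ^ p ∂P + ‖∫ ω', Z ω' ∂P‖ₑ ^ p) := by
        rw [lintegral_const_mul _ (by fun_prop), lintegral_add_left (by fun_prop)]
        simp
    _ ≤ 2 ^ (p - 1) * (∫⁻ ω, ‖Z ω‖ₑ ^ p ∂P + ∫⁻ ω, ‖Z ω‖ₑ ^ p ∂P) := by gcongr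
    _ = _ := by
        rw [← two_mul, ← mul_assoc]
        congr 1
        nth_rewrite 2 [← ENNReal.rpow_one 2]
        rw [← ENNReal.rpow_add _ _ (by norm_num) (by norm_num), sub_add_cancel]

variable [CompleteSpace B]

/-- In block `k` every index satisfies `i + 1 ≥ 2 ^ k`, so each uncentred `p`-th moment is at most
`2 ^ (-k) * E q(X)`. The `2 ^ k` terms restore `E q(X)`: the bound is uniform in `k`, although the
`p`-th moments need not be summable over all indices. -/
theorem IsRademacherType.exists_blockDeviation_le {p : ℝ} (hp : 1 ≤ p)
    (hB : IsRademacherType B p) (hXs : ∀ n, Measurable (Xs n))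
    (hind : iIndepFun Xs P) (hid : ∀ n, IdentDistrib (Xs n) X P P) :
    ∃ C : ℝ≥0, ∀ (g : B → B) (q : B → ℝ≥0∞), Measurable g → Measurable q →
      (∃ K, ∀ x, ‖g x‖ ≤ K * (1 + ‖x‖)) →
      (∀ (i : ℕ) x, ‖x‖ ≤ β i → ((i : ℝ≥0∞) + 1) * ‖(β i)⁻¹ • g x‖ₑ ^ p ≤ q x) →
      ∀ k, blockDeviation P β Xs g k ≤ 2 * (C * (2 ^ p * ∫⁻ ω, q (X ω) ∂P)) ^ (1 / p) := by
  have hp0 : 0 < p := by linarith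
  obtain ⟨C, hC⟩ := hB.exists_lintegral_norm_sum_le (P := P) hp
  refine ⟨C, fun g q hg hq hgK hgq k => ?_⟩
  have hinj : Function.Injective fun i : ℕ => 2 ^ k - 1 + i := add_right_injective _
  refine (hC (fun i => centeredTrunc P β Xs g (2 ^ k - 1 + i))
    (fun i => measurable_centeredTrunc hXs hg _)
    ((iIndepFun_centeredTrunc hind hg).precomp hinj)
    (fun i => integrable_centeredTrunc hXs hg hgK _)
    (fun i => integral_centeredTrunc hXs hg hgK _) _).trans ?_
  have hpt : ∀ (i : ℕ) x, ((i : ℝ≥0∞) + 1) * ‖truncScale β g i x‖ₑ ^ p ≤ q x := by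
    intro i x
    rcases le_or_gt ‖x‖ (β i) with h | h
    · rw [truncScale_of_le _ h]; exact hgq i x h
    · rw [truncScale_of_lt _ h]; simp [hp0]
  have hterm : ∀ i, ∫⁻ ω, ‖centeredTrunc P β Xs g (2 ^ k - 1 + i) ω‖ₑ ^ p ∂P ≤
      2 ^ p * (((2 ^ k - 1 + 1 : ℕ) : ℝ≥0∞)⁻¹ * ∫⁻ ω, q (X ω) ∂P) := by
    intro i
    have hm := (measurable_truncScale β hg (2 ^ k - 1 + i)).comp (hXs (2 ^ k - 1 + i))
    refine (lintegral_enorm_sub_integral_rpow_le hm hp).trans ?_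
    gcongr
    have e1 : ∫⁻ ω, q (X ω) ∂P = ∫⁻ ω, q (Xs (2 ^ k - 1 + i) ω) ∂P :=
      ((hid (2 ^ k - 1 + i)).comp hq).lintegral_eq.symm
    rw [e1, ← lintegral_const_mul _ (show Measurable fun ω => q (Xs (2 ^ k - 1 + i) ω) from
      hq.comp (hXs _))]
    refine lintegral_mono fun ω => ?_
    have h1 := hpt (2 ^ k - 1 + i) (Xs (2 ^ k - 1 + i) ω)
    rw [← ENNReal.mul_le_iff_le_inv (by simp) (ENNReal.natCast_ne_top _)]
    refine le_trans ?_ h1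
    simp only [Function.comp]
    gcongr
    push_cast
    gcongr
    exact le_self_add
  gcongr
  refine (Finset.sum_le_sum fun i _ => hterm i).trans_eq ?_
  rw [Finset.sum_const, Finset.card_range, nsmul_eq_mul]
  rw [mul_left_comm, ← mul_assoc (((2 ^ k - 1 + 1 : ℕ) : ℝ≥0∞)),
    ENNReal.mul_inv_cancel (by simp) (ENNReal.natCast_ne_top _), one_mul]

theorem tendsto_blockDeviation_simpleFunc (hXs : ∀ n, Measurable (Xs n)) (hind : iIndepFun Xs P)
    (hβ : Summable fun i => ((β i)⁻¹) ^ 2) (φ : SimpleFunc B B) :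
    Tendsto (blockDeviation P β Xs φ) atTop (𝓝 0) := by
  induction φ using SimpleFunc.induction with
  | const c hs =>
    have := tendsto_blockDeviation_indicator hXs hind hβ hs c
    convert this using 2
    funext x
    classical
    rw [Set.indicator_apply]
    simp [SimpleFunc.coe_piecewise, Set.piecewise]
  | add _ h1 h2 =>
    rename_i f g _
    have h3 := h1.add h2
    rw [add_zero] at h3
    refine tendsto_of_tendsto_of_tendsto_of_le_of_le tendsto_const_nhds h3 (fun k => zero_le)
      fun k => ?_
    exact blockDeviation_add_le hXs f.measurable g.measurable
      (exists_linear_growth_simpleFunc f) (exists_linear_growth_simpleFunc g) k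

/-- Split the identity into a simple function `φ n` and a remainder. The type bound makes the
remainder small uniformly in `k` once `n` is large; with `n` fixed, the simple part vanishes as `k →
∞`. -/
theorem IsNorming.tendsto_blockDeviation_id {p : ℝ} (h : IsNorming p β) (hp : 1 ≤ p)
    (hp2 : p < 2) (hB : IsRademacherType B p) (hX : Measurable X) (hXs : ∀ n, Measurable (Xs n))
    (hind : iIndepFun Xs P) (hid : ∀ n, IdentDistrib (Xs n) X P P)
    (hser : ∑' n, P {ω | β n < ‖X ω‖} < ∞) :
    Tendsto (blockDeviation P β Xs id) atTop (𝓝 0) := by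
  have hp0 : 0 < p := by linarith
  obtain ⟨C, hC⟩ := hB.exists_blockDeviation_le (β := β) hp hXs hind hid
  have hsep : TopologicalSpace.SeparableSpace (Set.univ : Set B) := inferInstance
  let φ : ℕ → SimpleFunc B B :=
    SimpleFunc.approxOn id measurable_id Set.univ 0 (Set.mem_univ 0)
  have hφ1 : ∀ n x, ‖x - φ n x‖ₑ ≤ ‖x‖ₑ := by
    intro n x
    have := SimpleFunc.edist_approxOn_le measurable_id (Set.mem_univ (0 : B)) x n
    rw [edist_comm, edist_eq_enorm_sub, edist_comm, edist_zero_right] at this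
    exact this
  have hφ2 : ∀ x, Tendsto (fun n => φ n x) atTop (𝓝 x) := fun x =>
    SimpleFunc.tendsto_approxOn measurable_id (Set.mem_univ (0 : B)) (by simp)
  let a : ℝ≥0∞ := ‖(β 0)⁻¹‖ₑ ^ p
  have ha : a ≠ ∞ := ENNReal.rpow_ne_top_of_nonneg hp0.le enorm_ne_top
  -- The first entry is an integrable majorant independent of `n`; the second tends to zero
  -- pointwise. Its constant `a` comes from `(i + 1) * (β i)⁻¹ ^ p ≤ (β 0)⁻¹ ^ p`.
  let q : ℕ → B → ℝ≥0∞ := fun n x => min (countBelow β ‖x‖ + 1) (a * ‖x - φ n x‖ₑ ^ p)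
  have hqm : ∀ n, Measurable (q n) := fun n =>
    (((measurable_countBelow β).comp measurable_norm).add_const _).min
      (((measurable_id.sub (φ n).measurable).enorm.pow_const p).const_mul a)
  have hgK : ∀ n, ∃ K, ∀ x, ‖x - φ n x‖ ≤ K * (1 + ‖x‖) := by
    refine fun n => ⟨1, fun x => ?_⟩
    have h1 : ‖x - φ n x‖ ≤ ‖x‖ := by simpa [enorm_le_iff_norm_le] using hφ1 n x
    linarith
  have hpt : ∀ n (i : ℕ) x, ‖x‖ ≤ β i →
      ((i : ℝ≥0∞) + 1) * ‖(β i)⁻¹ • (x - φ n x)‖ₑ ^ p ≤ q n x := by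
    intro n i x hx
    have hβi := h.pos i
    refine le_min ?_ ?_
    · refine le_trans ?_ (h.ofReal_mul_rpow_le_countBelow hp0 (norm_nonneg x) hx)
      rw [ENNReal.ofReal_mul (by positivity), ENNReal.ofReal_add (by positivity) (by positivity),
        ENNReal.ofReal_natCast, ENNReal.ofReal_one,
        ← ENNReal.ofReal_rpow_of_nonneg (by positivity) hp0.le]
      gcongr
      rw [enorm_smul, div_eq_inv_mul, ENNReal.ofReal_mul (by positivity), ofReal_norm,
        Real.enorm_of_nonneg (by positivity)]
      gcongr
      exact hφ1 n x
    · rw [enorm_smul, ENNReal.mul_rpow_of_nonneg _ _ hp0.le, ← mul_assoc]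
      gcongr
      have h0 := h.pos 0
      have h1 : ((i : ℝ) + 1) * ((β i)⁻¹) ^ p ≤ ((β 0)⁻¹) ^ p := by
        have h2 := Real.rpow_le_rpow (by positivity) (h.mul_rpow_le i) hp0.le
        rw [Real.mul_rpow h0.le (by positivity), ← Real.rpow_mul (by positivity), one_div,
          inv_mul_cancel₀ hp0.ne', Real.rpow_one] at h2
        rw [Real.inv_rpow hβi.le, Real.inv_rpow h0.le, ← div_eq_mul_inv, ← one_div,
          div_le_div_iff₀ (by positivity) (by positivity)]
        linarith
      have h2 := ENNReal.ofReal_le_ofReal h1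
      rw [ENNReal.ofReal_mul (by positivity), ENNReal.ofReal_add (by positivity) (by positivity),
        ENNReal.ofReal_natCast, ENNReal.ofReal_one,
        ← ENNReal.ofReal_rpow_of_nonneg (by positivity) hp0.le,
        ← ENNReal.ofReal_rpow_of_nonneg (by positivity) hp0.le] at h2
      simp only [a]
      rw [Real.enorm_of_nonneg (by positivity), Real.enorm_of_nonneg (by positivity)]
      exact h2
  have hle1 : ∀ n k, blockDeviation P β Xs (fun x => x - φ n x) k ≤
      2 * (C * (2 ^ p * ∫⁻ ω, q n (X ω) ∂P)) ^ (1 / p) := fun n k =>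
    hC _ (q n) (measurable_id.sub (φ n).measurable) (hqm n) (hgK n) (hpt n) k
  have hint : Tendsto (fun n => ∫⁻ ω, q n (X ω) ∂P) atTop (𝓝 0) := by
    have hb : ∫⁻ ω, (countBelow β ‖X ω‖ + 1) ∂P ≠ ∞ := by
      rw [lintegral_add_right _ measurable_const, lintegral_countBelow_norm hX]
      simp [hser.ne]
    have h1 := tendsto_lintegral_of_dominated_convergence (μ := P) (F := fun n ω => q n (X ω))
      (f := fun _ => 0) _ (fun n => (hqm n).comp hX)
      (fun n => ae_of_all _ fun ω => min_le_left _ _) hb (ae_of_all _ fun ω => ?_)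
    · simpa using h1
    · have h2 : Tendsto (fun n => ‖X ω - φ n (X ω)‖ₑ) atTop (𝓝 0) := by
        have hc : Continuous fun y : B => ‖X ω - y‖ₑ := by fun_prop
        simpa [Function.comp_def] using (hc.tendsto (X ω)).comp (hφ2 (X ω))
      have h3 := (ENNReal.continuous_rpow_const (y := p)).tendsto 0 |>.comp h2
      have h4 := ENNReal.Tendsto.const_mul (a := a) h3 (Or.inr ha)
      rw [ENNReal.zero_rpow_of_pos hp0, mul_zero] at h4
      exact tendsto_of_tendsto_of_tendsto_of_le_of_le tendsto_const_nhds h4 (fun k => zero_le)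
        fun n => min_le_right _ _
  have hlim : Tendsto (fun n => 2 * (C * (2 ^ p * ∫⁻ ω, q n (X ω) ∂P)) ^ (1 / p)) atTop
      (𝓝 0) := by
    have h2p : (2 : ℝ≥0∞) ^ p ≠ ∞ := ENNReal.rpow_ne_top_of_nonneg hp0.le (by norm_num)
    have h1 := ENNReal.Tendsto.const_mul (a := (C : ℝ≥0∞))
      (ENNReal.Tendsto.const_mul (a := (2 : ℝ≥0∞) ^ p) hint (Or.inr h2p))
      (Or.inr ENNReal.coe_ne_top)
    rw [mul_zero, mul_zero] at h1
    have h2 := (ENNReal.continuous_rpow_const (y := 1 / p)).tendsto 0 |>.comp h1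
    rw [ENNReal.zero_rpow_of_pos (by positivity)] at h2
    simpa using ENNReal.Tendsto.const_mul (a := (2 : ℝ≥0∞)) h2 (Or.inr (by norm_num))
  rw [ENNReal.tendsto_nhds_zero]
  intro ε hε
  have hε2 : 0 < ε / 2 := ENNReal.half_pos hε.ne'
  obtain ⟨n, hn⟩ := (ENNReal.tendsto_nhds_zero.1 hlim (ε / 2) hε2).exists
  have h1 := tendsto_blockDeviation_simpleFunc hXs hind (h.summable_inv_sq hp0 hp2) (φ n)
  filter_upwards [ENNReal.tendsto_nhds_zero.1 h1 (ε / 2) hε2] with k hk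
  have e : (id : B → B) = (fun x => x - φ n x) + φ n := by funext x; simp
  rw [e]
  refine (blockDeviation_add_le hXs (measurable_id.sub (φ n).measurable) (φ n).measurable
    (hgK n) (exists_linear_growth_simpleFunc _) k).trans ?_
  rw [← ENNReal.add_halves ε]
  exact add_le_add ((hle1 n k).trans hn) hk

end TruncatedBlocks

/-! ### The convergent case. -/

section StrongLaw

theorem indicator_eq_smul_truncScale {B Ω : Type*} [NormedAddCommGroup B] [NormedSpace ℝ B]
    {β : ℕ → ℝ} (hβ : ∀ i, 0 < β i) (i : ℕ) (Y : Ω → B) (ω : Ω) :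
    {ω | ‖Y ω‖ ≤ β i}.indicator Y ω = β i • truncScale β id i (Y ω) := by
  rcases le_or_gt ‖Y ω‖ (β i) with hi | hi
  · rw [truncScale_of_le _ hi, smul_inv_smul₀ (hβ i).ne']
    exact Set.indicator_of_mem (s := {ω | ‖Y ω‖ ≤ β i}) hi Y
  · rw [truncScale_of_lt _ hi, smul_zero]
    exact Set.indicator_of_notMem (s := {ω | ‖Y ω‖ ≤ β i}) (not_le.2 hi) Y

theorem integrable_indicator_norm_le {B Ω : Type*} [NormedAddCommGroup B] [MeasurableSpace B]
    [BorelSpace B] [TopologicalSpace.SeparableSpace B] [MeasurableSpace Ω] {P : Measure Ω}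
    [IsProbabilityMeasure P] {X : Ω → B} (hX : Measurable X) (c : ℝ) :
    Integrable ({ω | ‖X ω‖ ≤ c}.indicator X) P := by
  refine Integrable.of_bound
    (hX.indicator (measurableSet_le hX.norm measurable_const)).aestronglyMeasurable |c|
    (ae_of_all _ fun ω => ?_)
  rcases le_or_gt ‖X ω‖ c with hi | hi
  · rw [Set.indicator_of_mem (s := {ω | ‖X ω‖ ≤ c}) hi]
    exact hi.trans (le_abs_self c)
  · rw [Set.indicator_of_notMem (s := {ω | ‖X ω‖ ≤ c}) (not_le.2 hi)]; simp

variable {B : Type*} [NormedAddCommGroup B] [NormedSpace ℝ B]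
  [MeasurableSpace B] [BorelSpace B]
  {Ω : Type*} [MeasurableSpace Ω] {P : Measure Ω}
  {p : ℝ} {β : ℕ → ℝ} {X : Ω → B} {Xs : ℕ → Ω → B}

/-- The mean of `X` truncated at level `β i`. -/
noncomputable def truncMean (P : Measure Ω) (X : Ω → B) (β : ℕ → ℝ) (i : ℕ) : B :=
  ∫ ω, {ω | ‖X ω‖ ≤ β i}.indicator X ω ∂P

theorem smul_centeredTrunc (hβ : ∀ i, 0 < β i)
    (hid : ∀ n, IdentDistrib (Xs n) X P P) (i : ℕ) (ω : Ω) :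
    β i • centeredTrunc P β Xs id i ω =
      {ω | ‖Xs i ω‖ ≤ β i}.indicator (Xs i) ω - truncMean P X β i := by
  simp only [centeredTrunc, truncMean, smul_sub]
  rw [indicator_eq_smul_truncScale hβ]
  congr 1
  simp only [indicator_eq_smul_truncScale hβ]
  rw [integral_smul]
  congr 1
  exact ((hid i).comp (measurable_truncScale β measurable_id i)).integral_eq

variable [IsProbabilityMeasure P]

theorem IsNorming.summable_integral_norm_truncScale_sq (h : IsNorming p β) (hp : 0 < p)
    (hp2 : p < 2) (hX : Measurable X) (hXs : ∀ n, Measurable (Xs n))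
    (hid : ∀ n, IdentDistrib (Xs n) X P P) (hser : ∑' n, P {ω | β n < ‖X ω‖} < ∞) :
    Summable fun i => ∫ ω, ‖truncScale β id i (Xs i ω)‖ ^ 2 ∂P := by
  obtain ⟨C, hC⟩ := h.exists_tsum_sq_le_countBelow hp hp2
  have hm : ∀ i, Measurable fun x : B => ‖truncScale β id i x‖ ^ 2 := fun i =>
    (measurable_truncScale β measurable_id i).norm.pow_const 2
  have e : ∀ i, ∫ ω, ‖truncScale β id i (Xs i ω)‖ ^ 2 ∂P =
      (∫⁻ ω, ENNReal.ofReal (‖truncScale β id i (X ω)‖ ^ 2) ∂P).toReal := by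
    intro i
    have hmi : Measurable fun ω => ‖truncScale β id i (Xs i ω)‖ ^ 2 := (hm i).comp (hXs i)
    rw [integral_eq_lintegral_of_nonneg_ae (ae_of_all _ fun ω => sq_nonneg _)
      hmi.aestronglyMeasurable]
    congr 1
    exact ((hid i).comp (hm i).ennreal_ofReal).lintegral_eq
  simp only [e]
  refine ENNReal.summable_toReal ?_
  have hmX : ∀ i, Measurable fun ω => ENNReal.ofReal (‖truncScale β id i (X ω)‖ ^ 2) :=
    fun i => (hm i).ennreal_ofReal.comp hX
  rw [← lintegral_tsum fun i => (hmX i).aemeasurable]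
  have hle : ∀ ω, ∑' i, ENNReal.ofReal (‖truncScale β id i (X ω)‖ ^ 2) ≤
      C * (countBelow β ‖X ω‖ + 1) := by
    intro ω
    refine le_trans (le_of_eq ?_) (hC ‖X ω‖ (norm_nonneg _))
    congr 1; funext i
    split_ifs with hi
    · rw [truncScale_of_le _ hi, norm_smul, Real.norm_eq_abs, abs_of_pos (inv_pos.2 (h.pos i)),
        div_eq_inv_mul]; rfl
    · rw [truncScale_of_lt _ (not_le.1 hi)]; simp
  refine ne_top_of_le_ne_top ?_ (lintegral_mono hle)
  have hcm : Measurable fun ω => countBelow β ‖X ω‖ := (measurable_countBelow β).comp hX.norm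
  rw [lintegral_const_mul _ (hcm.add_const 1), lintegral_add_right _ measurable_const,
    lintegral_countBelow_norm hX]
  refine ENNReal.mul_ne_top ENNReal.coe_ne_top ?_
  simp [hser.ne]

variable [TopologicalSpace.SeparableSpace B]

/-- The difference of the means at levels `i ≤ n` lives on `β i < ‖X‖ ≤ β n`. Divided by `β n`, it
is dominated by `P (‖X‖ > β i)`, summable in `i`, and tends to zero for fixed `i`; dominated
convergence is applied first in `ω`, then in `i`. -/
theorem IsNorming.tendsto_sum_truncMean_sub (h : IsNorming p β) (hp : 0 < p)
    (hX : Measurable X) (hser : ∑' n, P {ω | β n < ‖X ω‖} < ∞) :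
    Tendsto (fun n : ℕ => ‖∑ i ∈ Finset.range (n + 1), truncMean P X β i -
      ((n : ℝ) + 1) • truncMean P X β n‖ / β n) atTop (𝓝 0) := by
  have hmono := h.monotone hp
  let G : ℕ → ℕ → Ω → ℝ := fun n i =>
    {ω | β i < ‖X ω‖ ∧ ‖X ω‖ ≤ β n}.indicator fun ω => ‖X ω‖ / β n
  have hms : ∀ n i, MeasurableSet {ω | β i < ‖X ω‖ ∧ ‖X ω‖ ≤ β n} := fun n i =>
    (measurableSet_lt measurable_const hX.norm).inter (measurableSet_le hX.norm measurable_const)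
  have hGm : ∀ n i, Measurable (G n i) := fun n i => (hX.norm.div_const _).indicator (hms n i)
  have hG0 : ∀ n i ω, 0 ≤ G n i ω := fun n i ω =>
    Set.indicator_nonneg (fun ω _ => div_nonneg (norm_nonneg _) (h.pos n).le) ω
  have hG1 : ∀ n i ω, G n i ω ≤ {ω | β i < ‖X ω‖}.indicator (fun _ => (1 : ℝ)) ω := by
    intro n i ω
    by_cases hω : ω ∈ {ω | β i < ‖X ω‖ ∧ ‖X ω‖ ≤ β n}
    · have h1 : ω ∈ {ω | β i < ‖X ω‖} := hω.1
      simp only [G]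
      rw [Set.indicator_of_mem hω, Set.indicator_of_mem h1]
      exact (div_le_one₀ (h.pos n)).2 hω.2
    · simp only [G]
      rw [Set.indicator_of_notMem hω]
      exact Set.indicator_nonneg (fun _ _ => zero_le_one) ω
  have hG2 : ∀ n i ω, G n i ω ≤ 1 := fun n i ω =>
    (hG1 n i ω).trans (Set.indicator_apply_le' (fun _ => le_rfl) fun _ => zero_le_one)
  have hGint : ∀ n i, Integrable (G n i) P := fun n i =>
    Integrable.of_bound (hGm n i).aestronglyMeasurable 1 (ae_of_all _ fun ω => by
      rw [Real.norm_eq_abs, abs_of_nonneg (hG0 n i ω)]; exact hG2 n i ω)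
  let t : ℕ → ℕ → ℝ := fun n i => ∫ ω, G n i ω ∂P
  have ht0 : ∀ n i, 0 ≤ t n i := fun n i => integral_nonneg (hG0 n i)
  have htb : ∀ n i, t n i ≤ P.real {ω | β i < ‖X ω‖} := by
    intro n i
    have hm : MeasurableSet {ω | β i < ‖X ω‖} := measurableSet_lt measurable_const hX.norm
    rw [← integral_indicator_one hm]
    exact integral_mono (hGint n i) ((integrable_const (1 : ℝ)).indicator hm) (hG1 n i)
  have hbs : Summable fun i => P.real {ω | β i < ‖X ω‖} := ENNReal.summable_toReal hser.ne
  have htl : ∀ i, Tendsto (fun n => t n i) atTop (𝓝 0) := by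
    intro i
    have h1 := tendsto_integral_of_dominated_convergence (μ := P) (F := fun n ω => G n i ω)
      (f := fun _ => 0) (fun _ => 1) (fun n => (hGm n i).aestronglyMeasurable)
      (integrable_const _)
      (fun n => ae_of_all _ fun ω => by
        rw [Real.norm_eq_abs, abs_of_nonneg (hG0 n i ω)]; exact hG2 n i ω)
      (ae_of_all _ fun ω => ?_)
    · simpa using h1
    · refine squeeze_zero (fun n => hG0 n i ω) (fun n => ?_)
        ((h.tendsto_atTop hp).const_div_atTop ‖X ω‖)
      exact Set.indicator_apply_le' (fun _ => le_rfl)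
        fun _ => div_nonneg (norm_nonneg _) (h.pos n).le
  have htsum : Tendsto (fun n => ∑' i, t n i) atTop (𝓝 0) := by
    have := tendsto_tsum_of_dominated_convergence (f := t) (g := fun _ => (0 : ℝ)) hbs htl
      (Eventually.of_forall fun n i => by
        rw [Real.norm_eq_abs, abs_of_nonneg (ht0 n i)]; exact htb n i)
    simpa using this
  refine squeeze_zero (fun n => div_nonneg (norm_nonneg _) (h.pos n).le) (fun n => ?_) htsum
  have hdiff : ∀ i ∈ Finset.range (n + 1), ‖truncMean P X β i - truncMean P X β n‖ ≤
      β n * t n i := by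
    intro i hi
    have hin : β i ≤ β n := hmono (by simp at hi; omega)
    have hn := h.pos n
    simp only [truncMean, t]
    rw [← integral_sub (integrable_indicator_norm_le hX _) (integrable_indicator_norm_le hX _),
      ← integral_const_mul]
    refine norm_integral_le_of_norm_le ((hGint n i).const_mul _) (ae_of_all _ fun ω => ?_)
    simp only [G, Set.indicator_apply, Set.mem_ofPred_eq]
    rcases le_or_gt ‖X ω‖ (β i) with h1 | h1
    · simp [h1, h1.trans hin, not_lt.2 h1]
    · rcases le_or_gt ‖X ω‖ (β n) with h2 | h2
      · simp [h1, h2, not_le.2 h1]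
        field_simp
        exact le_rfl
      · simp [not_le.2 h1, not_le.2 h2]
  have e : ∑ i ∈ Finset.range (n + 1), truncMean P X β i - ((n : ℝ) + 1) • truncMean P X β n =
      ∑ i ∈ Finset.range (n + 1), (truncMean P X β i - truncMean P X β n) := by
    rw [Finset.sum_sub_distrib, Finset.sum_const, Finset.card_range, ← Nat.cast_smul_eq_nsmul ℝ]
    push_cast; rfl
  rw [e, div_le_iff₀ (h.pos n)]
  calc _ ≤ ∑ i ∈ Finset.range (n + 1), β n * t n i :=
        (norm_sum_le _ _).trans (Finset.sum_le_sum hdiff)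
    _ = (∑ i ∈ Finset.range (n + 1), t n i) * β n := by rw [← Finset.mul_sum, mul_comm]
    _ ≤ _ := by
        have := h.pos n
        gcongr
        exact (hbs.of_nonneg_of_le (ht0 n) (htb n)).sum_le_tsum _ fun i _ => ht0 n i

/-- The strong law: if `∑ P (‖X‖ > β n)` converges, then the centred partial sums are
almost surely negligible with respect to `β`. -/
theorem IsNorming.ae_tendsto_norm_sum_sub_div [CompleteSpace B] (h : IsNorming p β) (hp : 1 ≤ p)
    (hp2 : p < 2) (hB : IsRademacherType B p) (hX : Measurable X) (hXs : ∀ n, Measurable (Xs n))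
    (hind : iIndepFun Xs P) (hid : ∀ n, IdentDistrib (Xs n) X P P)
    (hser : ∑' n, P {ω | β n < ‖X ω‖} < ∞) :
    ∀ᵐ ω ∂P, Tendsto (fun n : ℕ => ‖∑ i ∈ Finset.range (n + 1), Xs i ω -
      ((n : ℝ) + 1) • truncMean P X β n‖ / β n) atTop (𝓝 0) := by
  have hp0 : 0 < p := by linarith
  have hgK : ∃ K, ∀ x : B, ‖id x‖ ≤ K * (1 + ‖x‖) := ⟨1, fun x => by simp⟩
  have hZm : ∀ i, Measurable fun ω => truncScale β id i (Xs i ω) := fun i =>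
    (measurable_truncScale β measurable_id i).comp (hXs i)
  have hmean : Tendsto (fun k : ℕ => ∫ ω, ‖∑ i ∈ Finset.range (2 ^ k - 1 + 1),
      (truncScale β id (2 ^ k - 1 + i) (Xs (2 ^ k - 1 + i) ω) -
        ∫ ω', truncScale β id (2 ^ k - 1 + i) (Xs (2 ^ k - 1 + i) ω') ∂P)‖ ∂P) atTop (𝓝 0) := by
    have h1 := (ENNReal.tendsto_toReal ENNReal.zero_ne_top).comp
      (h.tendsto_blockDeviation_id hp hp2 hB hX hXs hind hid hser)
    rw [ENNReal.toReal_zero] at h1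
    refine h1.congr fun k => ?_
    rw [integral_norm_eq_lintegral_enorm]
    · rfl
    · exact (Finset.measurable_fun_sum _ fun i _ => (hZm _).sub_const _).aestronglyMeasurable
  have hblocks := ae_tendsto_maxPartialSum_dyadic (P := P)
    (Z := fun i ω => truncScale β id i (Xs i ω)) hZm
    (hind.comp (fun i => truncScale β id i) fun i => measurable_truncScale β measurable_id i)
    (fun i => by
      obtain ⟨K, hK⟩ := hgK
      exact MemLp.of_bound (hZm i).aestronglyMeasurable _
        (ae_of_all _ fun ω => norm_truncScale_le β hK i _))
    (h.summable_integral_norm_truncScale_sq hp0 hp2 hX hXs hid hser) hmean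
  have hbc : ∀ᵐ ω ∂P, ∀ᶠ i in atTop, ω ∉ {ω | β i < ‖Xs i ω‖} := by
    refine ae_eventually_notMem ?_
    have e : ∀ i, P {ω | β i < ‖Xs i ω‖} = P {ω | β i < ‖X ω‖} := fun i =>
      (hid i).measure_mem_eq (s := {x | β i < ‖x‖})
        (measurableSet_lt measurable_const measurable_norm)
    simp only [e]
    exact hser.ne
  have hcent := h.tendsto_sum_truncMean_sub hp0 hX hser
  filter_upwards [hblocks, hbc] with ω hω1 hω2
  have h1 := h.tendsto_norm_sum_smul_div hp0 (u := fun i => centeredTrunc P β Xs id i ω) hω1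
  let Y : ℕ → B := fun i => {ω | ‖Xs i ω‖ ≤ β i}.indicator (Xs i) ω
  have h2 : Tendsto (fun n => ‖∑ i ∈ Finset.range (n + 1), (Xs i ω - Y i)‖ / β n) atTop
      (𝓝 0) := by
    obtain ⟨N, hN⟩ := eventually_atTop.1 hω2
    have hz : ∀ i, N ≤ i → Xs i ω - Y i = 0 := by
      intro i hi
      have : ω ∈ {ω | ‖Xs i ω‖ ≤ β i} := not_lt.1 (hN i hi)
      simp only [Y]
      rw [Set.indicator_of_mem this, sub_self]
    refine ((h.tendsto_atTop hp0).const_div_atTop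
      ‖∑ i ∈ Finset.range N, (Xs i ω - Y i)‖).congr' ?_
    filter_upwards [eventually_ge_atTop N] with n hn
    congr 2
    refine Finset.sum_subset (Finset.range_mono (by omega)) fun i _ hi => hz i ?_
    simpa using hi
  have h3 := (h1.add h2).add hcent
  rw [add_zero, add_zero] at h3
  refine squeeze_zero (fun n => div_nonneg (norm_nonneg _) (h.pos n).le) (fun n => ?_) h3
  rw [← add_div, ← add_div]
  have hn := h.pos n
  gcongr
  -- Three errors: the centred truncated sums, the finitely many variables changed by truncation,
  -- and the discrepancy of the centrings.
  have e : ∑ i ∈ Finset.range (n + 1), Xs i ω - ((n : ℝ) + 1) • truncMean P X β n =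
      ∑ i ∈ Finset.range (n + 1), β i • centeredTrunc P β Xs id i ω +
      ∑ i ∈ Finset.range (n + 1), (Xs i ω - Y i) +
      (∑ i ∈ Finset.range (n + 1), truncMean P X β i - ((n : ℝ) + 1) • truncMean P X β n) := by
    simp only [smul_centeredTrunc h.pos hid, Finset.sum_sub_distrib, Y]
    abel
  rw [e]
  exact norm_add₃_le

end StrongLaw

/-! ### The divergent case. -/

section Divergence

variable {B : Type*} [NormedAddCommGroup B]
  {Ω : Type*} [MeasurableSpace Ω] {P : Measure Ω} [IsProbabilityMeasure P]
  {p : ℝ} {β : ℕ → ℝ} {X : Ω → B} {Xs : ℕ → Ω → B}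

/-- Multiplying the index by about `K ^ p` multiplies `β` by at least `K`, and such a change of
index alters the series only by a bounded multiplicity and an initial segment. -/
theorem IsNorming.tsum_measure_mul_lt_eq_top (h : IsNorming p β) (hp : 0 < p)
    (hser : ∑' n, P {ω | β n < ‖X ω‖} = ∞) {K : ℝ} (hK : 0 < K) :
    ∑' n, P {ω | K * β n < ‖X ω‖} = ∞ := by
  have hmono := h.monotone hp
  obtain ⟨m, hm⟩ := exists_nat_gt (K ^ p)
  have hKm : K ≤ ((m : ℝ) + 1) ^ (1 / p) := by
    have h1 : (K ^ p) ^ (1 / p) ≤ ((m : ℝ) + 1) ^ (1 / p) :=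
      Real.rpow_le_rpow (by positivity) (by linarith) (by positivity)
    rwa [← Real.rpow_mul hK.le, mul_one_div_cancel hp.ne', Real.rpow_one] at h1
  -- The successor of this index is exactly `(m + 1) * (n + 1)`.
  have hidx : ∀ n : ℕ, K * β n ≤ β (n * (m + 1) + m) := by
    intro n
    have h1 := h.div_le n (n * (m + 1) + m) (by nlinarith)
    have e : (((n * (m + 1) + m : ℕ) : ℝ) + 1) ^ (1 / p) =
        ((m : ℝ) + 1) ^ (1 / p) * ((n : ℝ) + 1) ^ (1 / p) := by
      rw [← Real.mul_rpow (by positivity) (by positivity)]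
      congr 1; push_cast; ring
    have hn := h.pos n
    rw [e, div_le_div_iff₀ (by positivity) (by positivity)] at h1
    have h2 : β n * ((m : ℝ) + 1) ^ (1 / p) ≤ β (n * (m + 1) + m) := by
      have h3 : (0 : ℝ) < ((n : ℝ) + 1) ^ (1 / p) := by positivity
      refine le_of_mul_le_mul_right ?_ h3
      linarith
    nlinarith
  -- The first `m + 1` terms are bounded trivially by `1`; later quotients are shifted by one so
  -- that `k` passes the index in `hidx`.
  let F : ℕ → ℝ≥0∞ := fun j => match j with
    | 0 => 1
    | n + 1 => P {ω | K * β n < ‖X ω‖}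
  have hle : ∀ k, P {ω | β k < ‖X ω‖} ≤ F (k / (m + 1)) := by
    intro k
    rcases hj : k / (m + 1) with _ | n
    · exact prob_le_one
    · refine measure_mono fun ω hω => ?_
      have hk : n * (m + 1) + m ≤ k := by
        have := Nat.div_mul_le_self k (m + 1)
        rw [hj] at this
        nlinarith
      exact ((hidx n).trans (hmono hk)).trans_lt hω
  have h1 : ∞ ≤ (∑' j, F j) * (m + 1) := by
    rw [← ENNReal.tsum_comp_div, ← hser]
    exact ENNReal.tsum_le_tsum hle
  have h2 : ∑' j, F j = ∞ := by
    by_contra hne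
    exact ENNReal.mul_ne_top hne (by simp) (top_le_iff.1 h1)
  exact ENNReal.tsum_add_one_eq_top h2 (by simp [F])

variable [MeasurableSpace B] [BorelSpace B]

theorem exists_measure_lt_norm_lt_half (hX : Measurable X) :
    ∃ R : ℕ, P {ω | (R : ℝ) < ‖X ω‖} < 1 / 2 := by
  have h1 := tendsto_measure_iInter_atTop (μ := P) (s := fun R : ℕ => {ω | (R : ℝ) < ‖X ω‖})
    (fun R => (measurableSet_lt measurable_const hX.norm).nullMeasurableSet)
    (fun R R' hR ω (hω : (R' : ℝ) < ‖X ω‖) =>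
      show (R : ℝ) < ‖X ω‖ from lt_of_le_of_lt (by exact_mod_cast hR) hω) ⟨0, measure_ne_top _ _⟩
  have h2 : ⋂ R : ℕ, {ω | (R : ℝ) < ‖X ω‖} = ∅ := by
    refine Set.eq_empty_of_forall_notMem fun ω hω => ?_
    obtain ⟨R, hR⟩ := exists_nat_gt ‖X ω‖
    exact lt_asymm hR (Set.mem_iInter.1 hω R)
  rw [h2, measure_empty] at h1
  exact (h1.eventually (gt_mem_nhds (by norm_num))).exists

/-- Were the series finite, its terms would tend to zero. Tightness of `X` would then force `‖d n‖ ≤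
2 * K * β n` eventually, so `‖Xs n‖ > 3 * K * β n` would imply the shifted event, contradicting
divergence at level `3 * K`. -/
theorem IsNorming.tsum_measure_lt_norm_sub_eq_top (h : IsNorming p β) (hp : 0 < p)
    (hX : Measurable X) (hid : ∀ n, IdentDistrib (Xs n) X P P)
    (hser : ∑' n, P {ω | β n < ‖X ω‖} = ∞) (d : ℕ → B) {K : ℝ} (hK : 0 < K) :
    ∑' n, P {ω | K * β n < ‖Xs n ω - d n‖} = ∞ := by
  by_contra hfin
  have h0 := ENNReal.tendsto_atTop_zero_of_tsum_ne_top hfin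
  obtain ⟨R, hR⟩ := exists_measure_lt_norm_lt_half (P := P) hX
  have hms : ∀ c : ℝ, MeasurableSet {x : B | c < ‖x‖} := fun c =>
    measurableSet_lt measurable_const measurable_norm
  have hlaw : ∀ (n : ℕ) (c : ℝ), P {ω | c < ‖Xs n ω‖} = P {ω | c < ‖X ω‖} := fun n c =>
    (hid n).measure_mem_eq (hms c)
  have hev : ∀ᶠ n in atTop, ‖d n‖ ≤ 2 * K * β n := by
    filter_upwards [h0.eventually (gt_mem_nhds (show (0 : ℝ≥0∞) < 1 / 2 by norm_num)),
      ((h.tendsto_atTop hp).const_mul_atTop hK).eventually_ge_atTop (R : ℝ)] with n h1 h2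
    have h3 : P ({ω | K * β n < ‖Xs n ω - d n‖} ∪ {ω | (R : ℝ) < ‖Xs n ω‖}) < 1 := by
      refine (measure_union_le _ _).trans_lt ?_
      rw [hlaw]
      exact (ENNReal.add_lt_add h1 hR).trans_eq (ENNReal.add_halves 1)
    obtain ⟨ω, hω⟩ : ∃ ω, ω ∉ {ω | K * β n < ‖Xs n ω - d n‖} ∪ {ω | (R : ℝ) < ‖Xs n ω‖} := by
      by_contra! hcon
      rw [Set.eq_univ_of_forall hcon, measure_univ] at h3
      exact lt_irrefl _ h3
    simp only [Set.mem_union, Set.mem_ofPred_eq, not_or, not_lt] at hω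
    have h4 : ‖d n‖ ≤ ‖Xs n ω‖ + ‖Xs n ω - d n‖ := by
      have := norm_sub_le (Xs n ω) (Xs n ω - d n)
      simpa using this
    linarith [hω.1, hω.2]
  obtain ⟨N, hN⟩ := eventually_atTop.1 hev
  have htail : ∑' n, P {ω | 3 * K * β (n + N) < ‖X ω‖} ≠ ∞ := by
    refine ne_top_of_le_ne_top hfin ?_
    refine le_trans (ENNReal.tsum_le_tsum fun n => ?_)
      (ENNReal.tsum_comp_le_tsum_of_injective (add_left_injective N)
        fun n => P {ω | K * β n < ‖Xs n ω - d n‖})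
    rw [← hlaw (n + N)]
    refine measure_mono fun ω hω => ?_
    have h1 := hN (n + N) (by omega)
    have h2 : 3 * K * β (n + N) < ‖Xs (n + N) ω‖ := hω
    have h3 := norm_sub_norm_le (Xs (n + N) ω) (d (n + N))
    show K * β (n + N) < ‖Xs (n + N) ω - d (n + N)‖
    linarith
  have htop := h.tsum_measure_mul_lt_eq_top hp hser (show 0 < 3 * K by positivity)
  rw [← ENNReal.summable.sum_add_tsum_nat_add' (k := N)] at htop
  rw [ENNReal.add_eq_top] at htop
  rcases htop with htop | htop
  · exact (ENNReal.sum_ne_top.2 fun i _ => measure_ne_top _ _) htop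
  · exact htail htop

theorem IsNorming.ae_frequently_lt_norm_sub (h : IsNorming p β) (hp : 0 < p)
    (hX : Measurable X) (hXs : ∀ n, Measurable (Xs n)) (hind : iIndepFun Xs P)
    (hid : ∀ n, IdentDistrib (Xs n) X P P)
    (hser : ∑' n, P {ω | β n < ‖X ω‖} = ∞) (d : ℕ → B) {K : ℝ} (hK : 0 < K) :
    ∀ᵐ ω ∂P, ∃ᶠ n in atTop, K * β n < ‖Xs n ω - d n‖ := by
  have hms : ∀ n, MeasurableSet {x : B | K * β n < ‖x - d n‖} := fun n =>
    (isOpen_lt continuous_const (by fun_prop)).measurableSet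
  have hms' : ∀ n, MeasurableSet {ω | K * β n < ‖Xs n ω - d n‖} := fun n => hXs n (hms n)
  have hset : iIndepSet (fun n => {ω | K * β n < ‖Xs n ω - d n‖}) P :=
    (iIndepSet_iff_meas_biInter hms').2 fun s =>
      hind.measure_inter_preimage_eq_mul s fun i _ => hms i
  have h1 := measure_limsup_eq_one hms' hset
    (h.tsum_measure_lt_norm_sub_eq_top hp hX hid hser d hK)
  have hlm : MeasurableSet (limsup (fun n => {ω | K * β n < ‖Xs n ω - d n‖}) atTop) :=
    MeasurableSet.measurableSet_limsup hms'
  filter_upwards [(prob_compl_eq_zero_iff hlm).2 h1] with ω hω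
  exact mem_limsup_iff_frequently_mem.1 hω

end Divergence

/-! ### Reindexing from `1` and the final dichotomy. -/

theorem isNorming_shift {p : ℝ} {b : ℕ → ℝ} (hb_pos : ∀ n, 1 ≤ n → 0 < b n)
    (hb_mono : ∀ m n : ℕ, 1 ≤ m → m ≤ n → b m / (m : ℝ) ^ (1 / p) ≤ b n / (n : ℝ) ^ (1 / p)) :
    IsNorming p fun n => b (n + 1) where
  pos n := hb_pos _ (by omega)
  div_le m n hmn := by exact_mod_cast hb_mono (m + 1) (n + 1) (by omega) (by omega)

theorem mainTheorem2 {B : Type*} [NormedAddCommGroup B] [NormedSpace ℝ B] [CompleteSpace B]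
    [TopologicalSpace.SeparableSpace B] [MeasurableSpace B] [BorelSpace B]
    (p : ℝ) (hp1 : 1 ≤ p) (hp2 : p < 2)
    (b : ℕ → ℝ) (hb_pos : ∀ n, 1 ≤ n → 0 < b n)
    (hb_mono : ∀ m n : ℕ, 1 ≤ m → m ≤ n → b m / (m : ℝ) ^ (1 / p) ≤ b n / (n : ℝ) ^ (1 / p))
    (hB : IsRademacherType B p)
    {Ω : Type*} [MeasurableSpace Ω] (P : Measure Ω) [IsProbabilityMeasure P]
    (X : Ω → B) (Xs : ℕ → Ω → B) (hX : Measurable X) (hXs : ∀ n, Measurable (Xs n))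
    (h_indep : iIndepFun Xs P) (h_ident : ∀ n, IdentDistrib (Xs n) X P P) :
    ((∀ᵐ ω ∂P, Tendsto (fun n : ℕ =>
          (b n)⁻¹ • (partialSum Xs n ω - truncCentering P X b n)) atTop (𝓝 0)) ↔
        ∑' n : ℕ, P {ω | b (n + 1) < ‖X ω‖} < ∞) ∧
      ((∀ᵐ ω ∂P, limsup (fun n : ℕ =>
          ((‖partialSum Xs n ω - truncCentering P X b n‖ / b n : ℝ) : EReal)) atTop = ⊤) ↔
        ∑' n : ℕ, P {ω | b (n + 1) < ‖X ω‖} = ∞) := by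
  have hp0 : 0 < p := by linarith
  have h : IsNorming p fun n => b (n + 1) := isNorming_shift hb_pos hb_mono
  have hmono := h.monotone hp0
  let D : ℕ → Ω → B := fun n ω => partialSum Xs n ω - truncCentering P X b n
  have hequiv : ∀ ω, Tendsto (fun n : ℕ => (b n)⁻¹ • D n ω) atTop (𝓝 0) ↔
      Tendsto (fun n : ℕ => ‖D n ω‖ / b n) atTop (𝓝 0) := by
    intro ω
    rw [tendsto_zero_iff_norm_tendsto_zero]
    refine tendsto_congr' ?_
    filter_upwards [eventually_ge_atTop 1] with n hn
    rw [norm_smul, Real.norm_eq_abs, abs_of_pos (inv_pos.2 (hb_pos n hn)), div_eq_inv_mul]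
  have hconv : ∑' n : ℕ, P {ω | b (n + 1) < ‖X ω‖} < ∞ →
      ∀ᵐ ω ∂P, Tendsto (fun n : ℕ => ‖D n ω‖ / b n) atTop (𝓝 0) := by
    intro hser
    filter_upwards [h.ae_tendsto_norm_sum_sub_div hp1 hp2 hB hX hXs h_indep h_ident hser]
      with ω hω
    rw [← tendsto_add_atTop_iff_nat 1]
    refine hω.congr fun n => ?_
    simp only [D, partialSum, truncCentering, truncMean]
    push_cast
    rfl
  have hdiv : ∑' n : ℕ, P {ω | b (n + 1) < ‖X ω‖} = ∞ →
      ∀ᵐ ω ∂P, limsup (fun n : ℕ => ((‖D n ω‖ / b n : ℝ) : EReal)) atTop = ⊤ := by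
    intro hser
    -- The shifted variable is the increment `D (n + 1) - D n`. The factor `2` ensures that one of
    -- its two ends exceeds `(K + 1) * b (n + 1)`.
    have hfreq : ∀ᵐ ω ∂P, ∀ K : ℕ, ∃ᶠ n in atTop, 2 * ((K : ℝ) + 1) * b (n + 1) <
        ‖Xs n ω - (truncCentering P X b (n + 1) - truncCentering P X b n)‖ :=
      ae_all_iff.2 fun K => h.ae_frequently_lt_norm_sub hp0 hX hXs h_indep h_ident hser
        (fun n => truncCentering P X b (n + 1) - truncCentering P X b n) (by positivity)
    filter_upwards [hfreq] with ω hω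
    have hK : ∀ K : ℕ, ∃ᶠ n in atTop, (K : ℝ) + 1 ≤ ‖D n ω‖ / b n := by
      intro K
      refine frequently_atTop.2 fun N => ?_
      -- Starting at `N + 1` keeps `n ≥ 1`, since nothing is known about `b 0`.
      obtain ⟨n, hn, hlt⟩ := frequently_atTop.1 (hω K) (N + 1)
      have e : Xs n ω - (truncCentering P X b (n + 1) - truncCentering P X b n) =
          D (n + 1) ω - D n ω := by
        simp only [D, partialSum, Finset.sum_range_succ]
        abel
      rw [e] at hlt
      have hb1 := hb_pos (n + 1) (by omega)
      have hb0 := hb_pos n (by omega)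
      have hbb : b n ≤ b (n + 1) := by
        have := hmono (show n - 1 ≤ n by omega)
        simpa [Nat.sub_add_cancel (show 1 ≤ n by omega)] using this
      have htri := norm_sub_le (D (n + 1) ω) (D n ω)
      by_cases hcase : ((K : ℝ) + 1) * b (n + 1) ≤ ‖D (n + 1) ω‖
      · exact ⟨n + 1, by omega, (le_div_iff₀ hb1).2 hcase⟩
      · refine ⟨n, by omega, (le_div_iff₀ hb0).2 ?_⟩
        have : ((K : ℝ) + 1) * b n ≤ ((K : ℝ) + 1) * b (n + 1) := by gcongr
        linarith [not_le.1 hcase]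
    rw [EReal.eq_top_iff_forall_lt]
    intro y
    obtain ⟨K, hKy⟩ := exists_nat_gt y
    have h1 : (((K : ℝ) + 1 : ℝ) : EReal) ≤
        limsup (fun n : ℕ => ((‖D n ω‖ / b n : ℝ) : EReal)) atTop :=
      le_limsup_of_frequently_le ((hK K).mono fun n hn => EReal.coe_le_coe_iff.2 hn)
    refine lt_of_lt_of_le (EReal.coe_lt_coe_iff.2 ?_) h1
    linarith
  have hexcl : ¬ ((∀ᵐ ω ∂P, Tendsto (fun n : ℕ => ‖D n ω‖ / b n) atTop (𝓝 0)) ∧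
      ∀ᵐ ω ∂P, limsup (fun n : ℕ => ((‖D n ω‖ / b n : ℝ) : EReal)) atTop = ⊤) := by
    rintro ⟨h1, h2⟩
    obtain ⟨ω, hω1, hω2⟩ := (h1.and h2).exists
    have h3 : Tendsto (fun n : ℕ => ((‖D n ω‖ / b n : ℝ) : EReal)) atTop (𝓝 ((0 : ℝ) : EReal)) :=
      (continuous_coe_real_ereal.tendsto 0).comp hω1
    rw [h3.limsup_eq] at hω2
    exact EReal.coe_ne_top 0 hω2
  have hiff : (∀ᵐ ω ∂P, Tendsto (fun n : ℕ => (b n)⁻¹ • D n ω) atTop (𝓝 0)) ↔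
      ∀ᵐ ω ∂P, Tendsto (fun n : ℕ => ‖D n ω‖ / b n) atTop (𝓝 0) := by
    simp only [hequiv]
  constructor
  · refine hiff.trans ⟨fun h1 => ?_, hconv⟩
    exact lt_top_iff_ne_top.2 fun htop => hexcl ⟨h1, hdiv htop⟩
  · refine ⟨fun h2 => ?_, hdiv⟩
    by_contra hne
    exact hexcl ⟨hconv (lt_top_iff_ne_top.2 hne), h2⟩
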